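/- Let $\mathbb F_q$ be a finite field of characteristic $p>3$ with $q$ elements, and let $\mathcal M$ be the generalized Artin–Mumford curve over $\mathbb F_q$, i.e. the projective closure of the plane curve $$(X^q-X)(Y^q-Y)=1 .$$ Let $\Sigma$ be the linear system of all plane conics (over the algebraic closure $K$ of $\mathbb F_q$) passing through the points $O_1=(1:0:0)$ and $O_2=(0:1:0)$. For a branch $\gamma$ of $\mathcal M$ (that is, a point of a non-singular model of $\mathcal M$ over $K$), let $b(\gamma)$ be the minimum of the intersection multiplicities $I(\mathcal C\cap\gamma)$ over the conics $\mathcal C\in\Sigma$ not having $\mathcal M$ as a component (the multiplicity of $\gamma$ in the base locus), and let $J(\gamma)$ be the set of the numbers $I(\mathcal C\cap\gamma)-b(\gamma)$ for these $\mathcal C$. A strictly increasing sequence $(\varepsilon_0,\dots,\varepsilon_r)$ of non-negative integers is called the order sequence of $\mathcal M$ with respect to $\Sigma$ if $J(\gamma)=\{\varepsilon_0,\dots,\varepsilon_r\}$ for all but finitely many branches $\gamma$ of $\mathcal M$; and $\mathcal M$ is called classical with respect to $\Sigma$ if its order sequence is $(0,1,\dots,r)$, and non-classical otherwise. Then $\mathcal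 M$ is non-classical with respect to $\Sigma$, and its order sequence with respect to $\Sigma$ is $(0,1,2,q)$. -/

import Mathlib

open Polynomial

/-! ### Plane curves, places, intersection multiplicities -/

namespace PlaneCurve

variable {K : Type*} [Field K]

/-- The affine coordinate ring `K[x, y]`, `f(x, y) = 0`, of the plane curve `f(X, Y) = 0`; the
inner variable of `K[X][Y]` is `X` and the outer one is `Y`. -/
abbrev CoordinateRing (f : K[X][X]) : Type _ := AdjoinRoot f

instance instIsDomainCoordinateRing (f : K[X][X]) [hf : Fact (Irreducible f)] :
    IsDomain (CoordinateRing f) :=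
  AdjoinRoot.isDomain_of_prime hf.out.prime

/-- The function field `K(x, y)` of an irreducible plane curve `f(X, Y) = 0` over `K`. -/
abbrev FunctionField (f : K[X][X]) : Type _ := FractionRing (CoordinateRing f)

/-- The coordinate function `x`. -/
noncomputable def xFun (f : K[X][X]) : FunctionField f :=
  algebraMap (CoordinateRing f) (FunctionField f) (AdjoinRoot.of f X)

/-- The coordinate function `y`. -/
noncomputable def yFun (f : K[X][X]) : FunctionField f :=
  algebraMap (CoordinateRing f) (FunctionField f) (AdjoinRoot.root f)

/-- The places of the function field of the curve over `K`: the normalized discrete valuations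
that are trivial on `K`. When `K` is algebraically closed these are the points of a non-singular
model of (the projective closure of) the curve, that is, its branches. -/
structure Place (f : K[X][X]) [Fact (Irreducible f)] where
  /-- The discrete valuation `v_P`. -/
  val : AddValuation (FunctionField f) (WithTop ℤ)
  val_const : ∀ c : K, c ≠ 0 → val (algebraMap K (FunctionField f) c) = 0
  val_surjective : Function.Surjective val

variable {f : K[X][X]} [Fact (Irreducible f)]

/-- The function `H(x, y, 1)` on the curve, for a polynomial `H(X, Y, Z)`. For `H` homogeneous
it is zero precisely when the curve `f = 0` is a component of the curve `H = 0`. -/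
noncomputable def restrict (f : K[X][X]) (H : MvPolynomial (Fin 3) K) : FunctionField f :=
  MvPolynomial.aeval ![xFun f, yFun f, 1] H

/-- The valuation as an integer (used for nonzero functions only). -/
noncomputable def Place.ord (P : Place f) (g : FunctionField f) : ℤ := (P.val g).untopD 0

/-- The minimum `min (v_P(x), v_P(y), v_P(1))` of the valuations of the homogeneous coordinates
`(x : y : 1)`; it is an integer since `v_P(1) = 0`. -/
noncomputable def Place.coordMin (P : Place f) : ℤ :=
  (min (min (P.val (xFun f)) (P.val (yFun f))) (P.val 1)).untopD 0

/-- The intersection multiplicity `I(P', H ∩ γ)` of the projective plane curve `H = 0`, with `H`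
homogeneous of degree `t` and not vanishing on the curve, with the branch `γ` (centred at `P'`)
corresponding to `P`: the valuation of `H` at homogeneous coordinates of the generic point that
are normalized to have minimal valuation `0` at `P`. If `γ` is centred at an affine point this is
`v_P(H(x, y, 1))`. -/
noncomputable def Place.intersectionMult (P : Place f) (t : ℕ) (H : MvPolynomial (Fin 3) K) : ℤ :=
  P.ord (restrict f H) - t * P.coordMin

/-! ### Linear systems and order sequences

A linear system of plane curves of degree `t` is given by a subspace `Λ` of the space of
homogeneous polynomials of degree `t` in three variables. -/

/-- All the intersection multiplicities at `P` of the members of the linear system that do not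
contain the curve as a component. -/
def Place.multSet (P : Place f) (t : ℕ) (Λ : Submodule K (MvPolynomial (Fin 3) K)) : Set ℤ :=
  {i | ∃ H ∈ Λ, restrict f H ≠ 0 ∧ P.intersectionMult t H = i}

/-- The orders at `P` of the linear series that `Λ` cuts out on the curve, after its base
locus is removed: `b` is the multiplicity of `P` in the base locus. -/
def Place.orderSet (P : Place f) (t : ℕ) (Λ : Submodule K (MvPolynomial (Fin 3) K)) : Set ℕ :=
  {j | ∃ b : ℤ, IsLeast (P.multSet t Λ) b ∧ b + j ∈ P.multSet t Λ}

/-- `(ε 0 < ⋯ < ε r)` is the order sequence of the curve with respect to `Λ`: it is the order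
sequence of all but finitely many branches. -/
def IsOrderSequence (f : K[X][X]) [Fact (Irreducible f)] (t : ℕ)
    (Λ : Submodule K (MvPolynomial (Fin 3) K)) {r : ℕ} (ε : Fin (r + 1) → ℕ) : Prop :=
  StrictMono ε ∧ {P : Place f | P.orderSet t Λ ≠ Set.range ε}.Finite

/-- The curve is classical with respect to `Λ`: its order sequence is `(0, 1, …, r)`. -/
def IsClassical (f : K[X][X]) [Fact (Irreducible f)] (t : ℕ)
    (Λ : Submodule K (MvPolynomial (Fin 3) K)) : Prop :=
  ∃ r : ℕ, IsOrderSequence f t Λ (fun i : Fin (r + 1) => (i : ℕ))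

/-- The linear system of the plane curves of degree `t` passing through the points (given by
homogeneous coordinates) of the set `S`. -/
def curvesThrough (K : Type*) [Field K] (t : ℕ) (S : Set (Fin 3 → K)) :
    Submodule K (MvPolynomial (Fin 3) K) where
  carrier := {H | H.IsHomogeneous t ∧ ∀ Q ∈ S, MvPolynomial.eval Q H = 0}
  add_mem' := fun ha hb => ⟨ha.1.add hb.1, fun Q hQ => by simp [ha.2 Q hQ, hb.2 Q hQ]⟩
  zero_mem' := ⟨MvPolynomial.isHomogeneous_zero _ _ _, fun Q _ => by simp⟩
  smul_mem' := fun c H hH => ⟨(MvPolynomial.homogeneousSubmodule (Fin 3) K t).smul_mem c hH.1,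
    fun Q hQ => by simp [MvPolynomial.smul_eval, hH.2 Q hQ]⟩

end PlaneCurve

/-! ### The generalized Artin-Mumford curve -/

/-- The polynomial `(X^q - X)(Y^q - Y) - 1` over `K`, where `q` is the order of the finite
field `F`. -/
noncomputable def artinMumford (F K : Type*) [Field F] [Field K] : K[X][X] :=
  C (X ^ Nat.card F - X) * (X ^ Nat.card F - X) - 1

/-- The polynomial `(X^q - X)(Y^q - Y) - 1` is irreducible over every field, for `q > 1`: its
reverse in `Y` is, up to sign, Eisenstein at `X`. -/
theorem artinMumford_irreducible_aux {K : Type*} [Field K] (q : ℕ) (hq : 1 < q) :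
    Irreducible (C (X ^ q - X) * (X ^ q - X) - 1 : K[X][X]) := by
  have hXq : (X ^ q - X : K[X]) ≠ 0 := by
    intro h
    have := congrArg (fun p => coeff p q) h
    simp [coeff_X, hq.ne] at this
  set c : K[X] := X ^ q - X with hc
  set f : K[X][X] := C c * (X ^ q - X) - 1 with hf
  have hf' : f = C c * X ^ q - C c * X ^ 1 - C 1 * X ^ 0 := by simp [hf]; ring
  have hcoeff : ∀ n, f.coeff n = (if n = q then c else 0) - (if n = 1 then c else 0)
      - (if n = 0 then 1 else 0) := by
    intro n
    rw [hf']
    simp only [coeff_sub, coeff_C_mul, coeff_X_pow, mul_ite, mul_one, mul_zero]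
  have hdeg : f.natDegree = q := by
    apply natDegree_eq_of_le_of_coeff_ne_zero
    · rw [natDegree_le_iff_coeff_eq_zero]
      intro n hn
      rw [hcoeff, if_neg (by omega), if_neg (by omega), if_neg (by omega)]
      simp
    · rw [hcoeff, if_pos rfl, if_neg (by omega), if_neg (by omega)]
      simpa using hXq
  have h0 : f.coeff 0 = -1 := by
    rw [hcoeff, if_neg (by omega), if_neg (by omega), if_pos rfl]; ring
  have hrev : ∀ n, f.reverse.coeff n = (if n = 0 then c else 0) - (if n = q - 1 then c else 0)
      - (if n = q then 1 else 0) := by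
    intro n
    rw [coeff_reverse, hdeg, hcoeff]
    rcases le_or_gt n q with h | h
    · rw [revAt_le h]
      congr 1
      · congr 1
        · congr 1; apply propext; omega
        · congr 1; apply propext; omega
      · congr 1; apply propext; omega
    · rw [revAt_eq_self_of_lt h]
      rw [if_neg (by omega), if_neg (by omega), if_neg (by omega),
        if_neg (by omega), if_neg (by omega), if_neg (by omega)]
  have hrdeg : f.reverse.natDegree = q := by
    rw [reverse_natDegree, hdeg, natTrailingDegree_eq_zero.2 (Or.inr (by simp [h0]))]; rfl
  have hlead : f.reverse.leadingCoeff = -1 := by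
    rw [leadingCoeff, hrdeg, hrev, if_neg (by omega), if_neg (by omega), if_pos rfl]; ring
  have hcX : c = X * (X ^ (q - 1) - 1) := by
    rw [hc]
    obtain ⟨m, rfl⟩ : ∃ m, q = m + 1 := ⟨q - 1, by omega⟩
    simp; ring
  have hP : (Ideal.span {(X : K[X])}).IsPrime :=
    (Ideal.span_singleton_prime X_ne_zero).2 prime_X
  have hirr : Irreducible f.reverse := by
    refine irreducible_of_eisenstein_criterion hP ?_ ?_ ?_ ?_ ?_
    · rw [hlead]
      exact fun h => hP.ne_top ((Ideal.eq_top_iff_one _).2 (by simpa using Ideal.neg_mem_iff _ |>.2 h))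
    · intro n hn
      rw [degree_eq_natDegree (by intro h; simp [h] at hlead), hrdeg] at hn
      have hn : n < q := by exact_mod_cast hn
      have hcm : c ∈ Ideal.span {(X : K[X])} := Ideal.mem_span_singleton.2 ⟨_, hcX⟩
      rw [hrev, if_neg (show n ≠ q by omega), sub_zero]
      refine Ideal.sub_mem _ ?_ ?_ <;> split_ifs <;> first | exact hcm | exact Ideal.zero_mem _
    · rw [← natDegree_pos_iff_degree_pos, hrdeg]; omega
    · rw [hrev, if_pos rfl, if_neg (by omega), if_neg (by omega), Ideal.span_singleton_pow,
        Ideal.mem_span_singleton, X_pow_dvd_iff]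
      intro h
      have := h 1 (by norm_num)
      simp [hc, coeff_X_pow, hq.ne] at this
    · intro r hr
      have := (C_dvd_iff_dvd_coeff _ _).1 hr q
      rw [hrev, if_neg (by omega), if_neg (by omega), if_pos rfl] at this
      exact isUnit_of_dvd_one (by simpa using this)
  have key : ∀ a b : K[X][X], f = a * b → IsUnit a.reverse → IsUnit a := by
    intro a b hab ha
    have ha0 : a.coeff 0 ≠ 0 := by
      intro h
      rw [hab, mul_coeff_zero, h] at h0
      simp at h0
    have h1 := natDegree_eq_zero_of_isUnit ha
    rw [reverse_natDegree, natTrailingDegree_eq_zero.2 (Or.inr ha0), Nat.sub_zero] at h1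
    rw [eq_C_of_natDegree_eq_zero h1, reverse_C] at ha
    rw [eq_C_of_natDegree_eq_zero h1]
    exact ha
  refine ⟨fun h => ?_, fun a b hab => ?_⟩
  · have := natDegree_eq_zero_of_isUnit h
    omega
  · rcases hirr.isUnit_or_isUnit (a := a.reverse) (b := b.reverse)
      (by rw [hab, reverse_mul_of_domain]) with h | h
    · exact Or.inl (key a b hab h)
    · exact Or.inr (key b a (by rw [hab, mul_comm]) h)

instance instFactIrreducibleArtinMumford (F K : Type*) [Field F] [Finite F] [Field K] :
    Fact (Irreducible (artinMumford F K)) :=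
  ⟨artinMumford_irreducible_aux _ Finite.one_lt_card⟩

/-- The linear system of the conics through `O₁ = (1 : 0 : 0)` and `O₂ = (0 : 1 : 0)`. -/
def conicsThroughO₁O₂ (K : Type*) [Field K] : Submodule K (MvPolynomial (Fin 3) K) :=
  PlaneCurve.curvesThrough K 2 {![1, 0, 0], ![0, 1, 0]}

/-! On the affine curve the conics through `O₁` and `O₂` cut out the space spanned by `1, x, y, xy`.
At a branch centred at `(a, b)` put `t = x - a`, `s = y - b`, `α = a^q - a`, `β = b^q - b`, so `αβ =
1`. Since `z ↦ z^q` is additive (hypothesis `hsub` below), the curve reads `(α + t^q - t)(β + s^q -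
s) = 1`, and both `t` and `s` are uniformizers. Let `N = βt + αs` and let `D = ts - N` be the
equation of the tangent hyperbola. The curve equation gives `D = -(βt^q + αs^q)` up to order `q +
1`, and tangency gives `αs = -βt` up to order 2; hence `D` has leading term `β(β^(2q-2) - 1)t^q`. If
`β^(2q-2) ≠ 1`, the basis `1, t, N, D` has orders `0, 1, 2, q`, and these are all the orders
(`val_hyperbola`, `setOf_val_eq`).

The exceptional branches are those where `x` or `y` has a pole and those with `β^(2q-2) = 1`. Only
finitely many centres occur, and each carries one branch, because the curve is smooth there in
suitable coordinates (`TrivialOn.eq_of_pos`); this gives `finite_orderSet_ne`.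

To refute classicality, two order sets that each hold at almost all branches must be compared at a
common branch. This needs infinitely many branches (`infinite_place`), which are built from power
series parametrizations. Then `{0, …, r} = {0, 1, 2, q}` is impossible, as `q > 3`. -/

/-! ### Valuations trivial on the constant field: uniformizers, uniqueness and existence of centres.
-/

theorem Algebra.exists_eq_add_mul_add_mul_of_mem_adjoin_pair {K L : Type*} [CommRing K]
    [CommRing L] [Algebra K L] {u s g : L} (hg : g ∈ Algebra.adjoin K {u, s}) :
    ∃ c : K, ∃ g₁ ∈ Algebra.adjoin K {u, s}, ∃ g₂ ∈ Algebra.adjoin K {u, s},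
      g = algebraMap K L c + u * g₁ + s * g₂ := by
  induction hg using Algebra.adjoin_induction with
  | mem x hx =>
    rcases hx with rfl | rfl
    · exact ⟨0, 1, one_mem _, 0, zero_mem _, by simp⟩
    · exact ⟨0, 0, zero_mem _, 1, one_mem _, by simp⟩
  | algebraMap c => exact ⟨c, 0, zero_mem _, 0, zero_mem _, by simp⟩
  | add g g' _ _ h h' =>
    obtain ⟨c, g₁, h₁, g₂, h₂, e⟩ := h
    obtain ⟨c', g₁', h₁', g₂', h₂', e'⟩ := h'
    exact ⟨c + c', g₁ + g₁', add_mem h₁ h₁', g₂ + g₂', add_mem h₂ h₂', by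
      rw [e, e', map_add]; ring⟩
  | mul g g' hg hg' h h' =>
    obtain ⟨c, g₁, h₁, g₂, h₂, e⟩ := h
    obtain ⟨c', g₁', h₁', g₂', h₂', e'⟩ := h'
    refine ⟨c * c', algebraMap K L c * g₁' + g₁ * g',
      add_mem (mul_mem (Subalgebra.algebraMap_mem _ _) h₁') (mul_mem h₁ hg'),
      algebraMap K L c * g₂' + g₂ * g',
      add_mem (mul_mem (Subalgebra.algebraMap_mem _ _) h₂') (mul_mem h₂ hg'), ?_⟩
    rw [map_mul, e, e']; ring

namespace AddValuation

section WithTopInt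

variable {L : Type*} [Field L] (v : AddValuation L (WithTop ℤ))

theorem exists_coe_eq {z : L} (hz : z ≠ 0) : ∃ m : ℤ, v z = m := by
  have := (v.ne_top_iff (x := z)).2 hz
  exact ⟨(v z).untop this, (WithTop.coe_untop _ _).symm⟩

theorem pow_eq_coe {z : L} {m : ℤ} (h : v z = m) (n : ℕ) :
    v (z ^ n) = ((n * m : ℤ) : WithTop ℤ) := by
  rw [map_pow, h, ← WithTop.coe_nsmul, nsmul_eq_mul]

theorem div_eq_coe {z w : L} {m n : ℤ} (h : v z = m) (h' : v w = n) :
    v (z / w) = ((m - n : ℤ) : WithTop ℤ) := by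
  rw [map_div, h, h']; rfl

theorem inv_eq_coe {w : L} {n : ℤ} (h' : v w = n) :
    v w⁻¹ = ((- n : ℤ) : WithTop ℤ) := by
  rw [map_inv, h']; rfl

end WithTopInt

/-- A valuation of an extension `L` of `K` is trivial on `K`. -/
def TrivialOn (K : Type*) {L : Type*} [Field K] [Field L] [Algebra K L]
    (v : AddValuation L (WithTop ℤ)) : Prop :=
  ∀ c : K, c ≠ 0 → v (algebraMap K L c) = 0

variable {K L : Type*} [Field K] [Field L] [Algebra K L] {v v' : AddValuation L (WithTop ℤ)}

theorem TrivialOn.nonneg (hv : TrivialOn K v) (c : K) : 0 ≤ v (algebraMap K L c) := by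
  by_cases h : c = 0
  · simp [h]
  · rw [hv c h]

theorem TrivialOn.eq_of_sub_pos (hv : TrivialOn K v) {z : L} {a b : K}
    (ha : 0 < v (z - algebraMap K L a)) (hb : 0 < v (z - algebraMap K L b)) : a = b := by
  by_contra hab
  have h1 := hv (b - a) (sub_ne_zero.2 (Ne.symm hab))
  have h2 : 0 < v ((z - algebraMap K L a) + -(z - algebraMap K L b)) :=
    v.map_lt_add ha (by rwa [map_neg])
  rw [_root_.map_sub] at h1
  rw [show (z - algebraMap K L a) + -(z - algebraMap K L b)
    = algebraMap K L b - algebraMap K L a by ring, h1] at h2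
  exact lt_irrefl _ h2

theorem TrivialOn.add_eq_zero_of_pos (hv : TrivialOn K v) {c : K} (hc : c ≠ 0) {z : L}
    (hz : 0 < v z) : v (algebraMap K L c + z) = 0 := by
  have h := hv c hc
  rw [map_add_eq_of_lt_left v (by rwa [h]), h]

theorem TrivialOn.nonneg_of_mem_adjoin (hv : TrivialOn K v) {S : Set L} (hS : ∀ s ∈ S, 0 ≤ v s)
    {g : L} (hg : g ∈ Algebra.adjoin K S) : 0 ≤ v g := by
  induction hg using Algebra.adjoin_induction with
  | mem x hx => exact hS x hx
  | algebraMap c => exact hv.nonneg c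
  | add g g' _ _ h h' => exact v.map_le_add h h'
  | mul g g' _ _ h h' => rw [v.map_mul]; exact add_nonneg h h'

section Uniformizer

variable {u s w w' : L}

/-- If the maximal ideal `(u, s)` of `K[u, s]` is locally generated by `u`, every nonzero element
of `K[u, s]` is locally a power of `u` times a unit. -/
theorem TrivialOn.exists_mul_pow_eq (hv : TrivialOn K v) (hv' : TrivialOn K v')
    (hu : 0 < v u) (hs : 0 < v s) (hu' : 0 < v' u) (hs' : 0 < v' s)
    (hw : w ∈ Algebra.adjoin K {u, s}) (hw' : w' ∈ Algebra.adjoin K {u, s})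
    (h : s * w = u * w') (hvw : v w = 0) (hvw' : v' w = 0) {g : L}
    (hg : g ∈ Algebra.adjoin K {u, s}) (hg0 : g ≠ 0) :
    ∃ n : ℕ, ∃ h ∈ Algebra.adjoin K {u, s}, v h = 0 ∧ v' h = 0 ∧ g * w ^ n = u ^ n * h := by
  have hS : ∀ z ∈ ({u, s} : Set L), 0 ≤ v z := by
    rintro z (rfl | rfl)
    exacts [hu.le, hs.le]
  have hS' : ∀ z ∈ ({u, s} : Set L), 0 ≤ v' z := by
    rintro z (rfl | rfl)
    exacts [hu'.le, hs'.le]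
  have hw0 : w ≠ 0 := by
    rintro rfl
    simp at hvw
  obtain ⟨m, hm⟩ := v.exists_coe_eq hg0
  have hm0 : 0 ≤ m := by
    have := hv.nonneg_of_mem_adjoin hS hg
    rw [hm] at this
    exact_mod_cast this
  lift m to ℕ using hm0
  induction m using Nat.strong_induction_on generalizing g with
  | _ m ih =>
  obtain ⟨c, g₁, h₁, g₂, h₂, e⟩ := Algebra.exists_eq_add_mul_add_mul_of_mem_adjoin_pair hg
  by_cases hc : c = 0
  -- Without constant term `g` lies in `(u, s)`. Multiplying by `w` turns `s * w` into `u * w'`, so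
  -- a factor `u` splits off; the cofactor has smaller value because `v u > 0`, and the induction is
  -- on that value.
  · set g' := g₁ * w + w' * g₂ with hg'
    have hmem' : g' ∈ Algebra.adjoin K {u, s} := add_mem (mul_mem h₁ hw) (mul_mem hw' h₂)
    have e' : g * w = u * g' := by
      rw [e, hc, _root_.map_zero, hg']
      linear_combination g₂ * h
    have hg'0 : g' ≠ 0 := by
      intro h0
      rw [h0, mul_zero] at e'
      exact mul_ne_zero hg0 hw0 e'
    have hu0 : u ≠ 0 := by
      rintro rfl
      rw [zero_mul] at e'
      exact mul_ne_zero hg0 hw0 e'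
    obtain ⟨m', hm'⟩ := v.exists_coe_eq hg'0
    obtain ⟨k, hk⟩ := v.exists_coe_eq hu0
    have hm'0 : 0 ≤ m' := by
      have := hv.nonneg_of_mem_adjoin hS hmem'
      rw [hm'] at this
      exact_mod_cast this
    lift m' to ℕ using hm'0
    have hk0 : 0 < k := by
      rw [hk] at hu
      exact_mod_cast hu
    have hsum : (m : ℤ) = k + m' := by
      have := congrArg v e'
      rw [map_mul, map_mul, hvw, hm, hm', hk, add_zero] at this
      exact_mod_cast this
    obtain ⟨n, h, hh, h1, h2, h3⟩ := ih m' (by omega) hmem' hg'0 hm'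
    refine ⟨n + 1, h, hh, h1, h2, ?_⟩
    rw [pow_succ', ← mul_assoc, e', mul_assoc, h3]
    ring
  -- A nonzero constant term makes `g` a unit for both valuations, so the exponent is 0.
  · have hpos : 0 < v (u * g₁ + s * g₂) := by
      refine v.map_lt_add ?_ ?_ <;> rw [map_mul]
      · exact add_pos_of_pos_of_nonneg hu (hv.nonneg_of_mem_adjoin hS h₁)
      · exact add_pos_of_pos_of_nonneg hs (hv.nonneg_of_mem_adjoin hS h₂)
    have hpos' : 0 < v' (u * g₁ + s * g₂) := by
      refine v'.map_lt_add ?_ ?_ <;> rw [map_mul]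
      · exact add_pos_of_pos_of_nonneg hu' (hv'.nonneg_of_mem_adjoin hS' h₁)
      · exact add_pos_of_pos_of_nonneg hs' (hv'.nonneg_of_mem_adjoin hS' h₂)
    refine ⟨0, g, hg, ?_, ?_, by simp⟩
    · rw [e, add_assoc]
      exact hv.add_eq_zero_of_pos hc hpos
    · rw [e, add_assoc]
      exact hv'.add_eq_zero_of_pos hc hpos'

/-- Under the same assumption, both valuations are given by the exponent of `u`. -/
theorem TrivialOn.exists_val_eq_mul (htop : IntermediateField.adjoin K {u, s} = ⊤)
    (hv : TrivialOn K v) (hv' : TrivialOn K v')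
    (hu : 0 < v u) (hs : 0 < v s) (hu' : 0 < v' u) (hs' : 0 < v' s)
    (hw : w ∈ Algebra.adjoin K {u, s}) (hw' : w' ∈ Algebra.adjoin K {u, s})
    (h : s * w = u * w') (hvw : v w = 0) (hvw' : v' w = 0) {k k' : ℤ} (hk : v u = k)
    (hk' : v' u = k') {z : L} (hz : z ≠ 0) :
    ∃ m : ℤ, v z = ((m * k : ℤ) : WithTop ℤ) ∧ v' z = ((m * k' : ℤ) : WithTop ℤ) := by
  have key : ∀ g ∈ Algebra.adjoin K {u, s}, g ≠ 0 →
      ∃ n : ℤ, v g = ((n * k : ℤ) : WithTop ℤ) ∧ v' g = ((n * k' : ℤ) : WithTop ℤ) := by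
    intro g hg hg0
    obtain ⟨n, h, -, h1, h2, h3⟩ :=
      hv.exists_mul_pow_eq hv' hu hs hu' hs' hw hw' h hvw hvw' hg hg0
    refine ⟨n, ?_, ?_⟩
    · have := congrArg v h3
      rwa [map_mul, map_mul, h1, map_pow, hvw, smul_zero, add_zero, add_zero,
        pow_eq_coe v hk] at this
    · have := congrArg v' h3
      rwa [map_mul, map_mul, h2, map_pow, hvw', smul_zero, add_zero, add_zero,
        pow_eq_coe v' hk'] at this
  have hmem : z ∈ IntermediateField.adjoin K {u, s} := htop ▸ IntermediateField.mem_top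
  obtain ⟨r, hr, t, ht, rfl⟩ := IntermediateField.mem_adjoin_iff_div.1 hmem
  obtain ⟨n, h1, h2⟩ := key r hr (by rintro rfl; simp at hz)
  obtain ⟨n', h1', h2'⟩ := key t ht (by rintro rfl; simp at hz)
  refine ⟨n - n', ?_, ?_⟩
  · rw [div_eq_coe v h1 h1', sub_mul]
  · rw [div_eq_coe v' h2 h2', sub_mul]

/-- All values are multiples of `v u`, and the value 1 is attained. -/
theorem TrivialOn.val_eq_one (htop : IntermediateField.adjoin K {u, s} = ⊤)
    (hv : TrivialOn K v) (hsurj : Function.Surjective v) (hu : 0 < v u) (hs : 0 < v s)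
    (hw : w ∈ Algebra.adjoin K {u, s}) (hw' : w' ∈ Algebra.adjoin K {u, s})
    (h : s * w = u * w') (hvw : v w = 0) : v u = 1 := by
  -- If `u = 0`, then `s = 0` as well and the field is `K`, on which the value 1 does not occur.
  have hu0 : u ≠ 0 := by
    rintro rfl
    have hs0 : s = 0 := by
      rw [zero_mul, mul_eq_zero] at h
      exact h.resolve_right (by rintro rfl; simp at hvw)
    obtain ⟨z, hz⟩ := hsurj 1
    have hmem : z ∈ IntermediateField.adjoin K ({0, s} : Set L) :=
      htop ▸ IntermediateField.mem_top
    have : IntermediateField.adjoin K ({0, s} : Set L) = ⊥ := by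
      rw [eq_bot_iff, IntermediateField.adjoin_le_iff, hs0]
      rintro t (rfl | rfl) <;> exact zero_mem _
    rw [this, IntermediateField.mem_bot] at hmem
    obtain ⟨c, rfl⟩ := hmem
    by_cases hc : c = 0
    · simp [hc] at hz
    · rw [hv c hc] at hz
      exact absurd hz (by decide)
  obtain ⟨k, hk⟩ := v.exists_coe_eq hu0
  obtain ⟨z, hz⟩ := hsurj 1
  obtain ⟨m, hm, -⟩ := hv.exists_val_eq_mul htop hv hu hs hu hs hw hw' h hvw hvw hk hk
    (z := z) (by rintro rfl; rw [map_zero] at hz; exact absurd hz (by decide))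
  rw [hz] at hm
  have h1 : m * k = 1 := by exact_mod_cast hm.symm
  have h2 : 0 < k := by rw [hk] at hu; exact_mod_cast hu
  have h3 : k = 1 := Int.eq_one_of_mul_eq_one_left h2.le h1
  rw [hk, h3]; rfl

/-- Uniqueness of the branch at a smooth centre: both valuations of an element equal the same
exponent of `u`, since both are normalized by `v u = v' u = 1`. -/
theorem TrivialOn.eq_of_pos (htop : IntermediateField.adjoin K {u, s} = ⊤)
    (hv : TrivialOn K v) (hv' : TrivialOn K v')
    (hsurj : Function.Surjective v) (hsurj' : Function.Surjective v')
    (hu : 0 < v u) (hs : 0 < v s) (hu' : 0 < v' u) (hs' : 0 < v' s)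
    (hw : w ∈ Algebra.adjoin K {u, s}) (hw' : w' ∈ Algebra.adjoin K {u, s})
    (h : s * w = u * w') (hvw : v w = 0) (hvw' : v' w = 0) : v = v' := by
  have h1 := hv.val_eq_one htop hsurj hu hs hw hw' h hvw
  have h2 := hv'.val_eq_one htop hsurj' hu' hs' hw hw' h hvw'
  refine AddValuation.ext fun z => ?_
  by_cases hz : z = 0
  · simp [hz]
  · obtain ⟨m, hm, hm'⟩ := hv.exists_val_eq_mul htop hv' hu hs hu' hs' hw hw' h hvw hvw'
      (k := 1) (k' := 1) h1 h2 hz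
    rw [hm, hm']

end Uniformizer

/-- A valuation that is trivial on a field is non-negative on elements integral over it. -/
theorem TrivialOn.nonneg_of_isIntegral (hv : TrivialOn K v) {z : L} (hz : IsIntegral K z) : 0 ≤ v z := by
  by_contra! hneg
  obtain ⟨f, hf, h0⟩ := hz
  obtain ⟨m, hm⟩ := v.exists_coe_eq (z := z) (by rintro rfl; simp at hneg)
  have hm0 : m < 0 := by rw [hm] at hneg; exact_mod_cast hneg
  rw [eval₂_eq_sum_range, Finset.sum_range_succ, hf.coeff_natDegree, _root_.map_one, one_mul,
    add_eq_zero_iff_eq_neg] at h0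
  -- If `z` had a pole, the leading power would have strictly smaller value than all the lower
  -- terms, to which it is equal up to sign.
  have h1 : v (z ^ f.natDegree) <
      v (∑ i ∈ Finset.range f.natDegree, algebraMap K L (f.coeff i) * z ^ i) := by
    rw [pow_eq_coe v hm]
    refine v.map_lt_sum' (WithTop.coe_lt_top _) fun i hi => ?_
    rw [map_mul, pow_eq_coe v hm]
    refine lt_of_lt_of_le ?_ (le_add_of_nonneg_left (hv.nonneg _))
    have : (i : ℤ) < f.natDegree := by exact_mod_cast Finset.mem_range.1 hi
    exact_mod_cast (mul_lt_mul_of_neg_right this hm0)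
  rw [h0, map_neg] at h1
  exact lt_irrefl _ h1

/-- The residue field is `K`. If no `x - a` had positive value, every linear factor, hence every
nonzero polynomial in `x`, would have value 0. The valuation would then be trivial on `K(x)`, so
non-negative on its algebraic extension `L`, against the value `-1` being attained. -/
theorem TrivialOn.exists_sub_pos [IsAlgClosed K] (hv : TrivialOn K v)
    (hsurj : Function.Surjective v) {x : L}
    [Algebra.IsAlgebraic (IntermediateField.adjoin K {x}) L] (hx : 0 ≤ v x) :
    ∃ a : K, 0 < v (x - algebraMap K L a) := by
  by_contra! hneg
  have h1 : ∀ a : K, v (x + algebraMap K L a) = 0 := fun a => by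
    refine le_antisymm ?_ (v.map_le_add hx (hv.nonneg a))
    simpa using hneg (-a)
  have h2 : ∀ g : K[X], g ≠ 0 → v (aeval x g) = 0 := fun g => by
    induction IsAlgClosed.splits g using Submonoid.closure_induction with
    | mem g hg =>
      rcases hg with ⟨a, rfl⟩ | ⟨a, rfl⟩
      · intro hg
        simpa using hv a (by rintro rfl; simp at hg)
      · intro _
        simpa using h1 a
    | one => simp
    | mul f g _ _ hf hg =>
      intro h
      rw [_root_.map_mul, map_mul, hf (left_ne_zero_of_mul h), hg (right_ne_zero_of_mul h), add_zero]
  have h3 : TrivialOn (IntermediateField.adjoin K {x}) v := by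
    rintro ⟨c, hc⟩ hc0
    obtain ⟨r, s, rfl⟩ := (IntermediateField.mem_adjoin_simple_iff K c).1 hc
    have hr : r ≠ 0 := by rintro rfl; exact hc0 (Subtype.ext (by simp))
    have hs : s ≠ 0 := by rintro rfl; exact hc0 (Subtype.ext (by simp))
    change v (aeval x r / aeval x s) = 0
    rw [div_eq_coe v (h2 r hr) (h2 s hs)]
    rfl
  obtain ⟨z, hz⟩ := hsurj (-1 : ℤ)
  have := h3.nonneg_of_isIntegral (Algebra.IsAlgebraic.isAlgebraic z).isIntegral
  rw [hz] at this
  exact absurd this (by decide)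

end AddValuation

theorem IntermediateField.isAlgebraic_adjoin_simple_of_adjoin_pair_eq_top {K L : Type*} [Field K]
    [Field L] [Algebra K L] {x y : L} (htop : IntermediateField.adjoin K {x, y} = ⊤)
    (hy : IsIntegral (IntermediateField.adjoin K {x}) y) :
    Algebra.IsAlgebraic (IntermediateField.adjoin K {x}) L := by
  have h := IntermediateField.isAlgebraic_adjoin (S := {y}) (K := IntermediateField.adjoin K {x})
    (by simpa using hy)
  have htop' : IntermediateField.adjoin (IntermediateField.adjoin K {x}) {y} = ⊤ := by
    rw [← IntermediateField.restrictScalars_eq_top_iff (K := K), IntermediateField.adjoin_adjoin_left,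
      Set.singleton_union, htop]
  rw [htop'] at h
  exact (IntermediateField.topEquiv.isAlgebraic_iff).1 h

/-! ### Places of the curve: centres, and uniqueness of the place at each centre. -/

namespace ArtinMumford

variable {K L : Type*} [Field K] [Field L] [Algebra K L] {q : ℕ} {x y : L}

theorem isAlgebraic (hq : 1 < q) (hxy : (x ^ q - x) * (y ^ q - y) = 1)
    (htop : IntermediateField.adjoin K {x, y} = ⊤) :
    Algebra.IsAlgebraic (IntermediateField.adjoin K {x}) L := by
  refine IntermediateField.isAlgebraic_adjoin_simple_of_adjoin_pair_eq_top htop ?_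
  set g := IntermediateField.AdjoinSimple.gen K x
  refine ⟨X ^ q + (- X - C (g ^ q - g)⁻¹), monic_X_pow_add ?_, ?_⟩
  · refine lt_of_le_of_lt (b := (1 : WithBot ℕ)) ?_ (by exact_mod_cast hq)
    refine (degree_sub_le _ _).trans (max_le (by simp) (degree_C_le.trans (by simp)))
  · have : algebraMap (IntermediateField.adjoin K {x}) L (g ^ q - g)⁻¹ = y ^ q - y := by
      rw [map_inv₀, map_sub, map_pow, IntermediateField.AdjoinSimple.algebraMap_gen]
      exact inv_eq_of_mul_eq_one_right hxy
    simp only [eval₂_add, eval₂_pow, eval₂_X, eval₂_sub, eval₂_neg, eval₂_C, this]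
    ring

theorem adjoin_swap (htop : IntermediateField.adjoin K {x, y} = ⊤) :
    IntermediateField.adjoin K {y, x} = ⊤ := by
  rwa [Set.pair_comm]

theorem adjoin_sub_sub (htop : IntermediateField.adjoin K {x, y} = ⊤) (a b : K) :
    IntermediateField.adjoin K {x - algebraMap K L a, y - algebraMap K L b} = ⊤ := by
  rw [eq_top_iff, ← htop, IntermediateField.adjoin_le_iff]
  have h1 := IntermediateField.mem_adjoin_pair_left K (x - algebraMap K L a) (y - algebraMap K L b)
  have h2 := IntermediateField.mem_adjoin_pair_right K (x - algebraMap K L a) (y - algebraMap K L b)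
  rintro z (rfl | rfl)
  · simpa using add_mem h1 (IntermediateField.algebraMap_mem _ a)
  · simpa using add_mem h2 (IntermediateField.algebraMap_mem _ b)

theorem adjoin_inv_sub (htop : IntermediateField.adjoin K {x, y} = ⊤) (b : K) :
    IntermediateField.adjoin K {x⁻¹, y - algebraMap K L b} = ⊤ := by
  rw [eq_top_iff, ← htop, IntermediateField.adjoin_le_iff]
  have h1 := IntermediateField.mem_adjoin_pair_left K x⁻¹ (y - algebraMap K L b)
  have h2 := IntermediateField.mem_adjoin_pair_right K x⁻¹ (y - algebraMap K L b)
  rintro z (rfl | rfl)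
  · simpa using inv_mem h1
  · simpa using add_mem h2 (IntermediateField.algebraMap_mem _ b)

section Valuation

open AddValuation

variable {v v' : AddValuation L (WithTop ℤ)}

theorem val_pow_pos (hq : 0 < q) {z : L} (hz : 0 < v z) : 0 < v (z ^ q) := by
  obtain ⟨m, rfl⟩ : ∃ m, q = m + 1 := ⟨q - 1, by omega⟩
  induction m with
  | zero => simpa using hz
  | succ m ih =>
    rw [pow_succ, v.map_mul]
    exact add_pos_of_pos_of_nonneg (ih (by omega)) hz.le

theorem val_one_sub_pow (hq : 1 < q) {z : L} (hz : 0 < v z) : v (1 - z ^ (q - 1)) = 0 := by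
  have := val_pow_pos (show 0 < q - 1 by omega) hz
  rw [map_sub_eq_of_lt_left v (by rwa [v.map_one]), v.map_one]

theorem val_pow_sub_self_pos (hq : 0 < q) {z : L} (hz : 0 < v z) : 0 < v (z ^ q - z) := by
  rw [sub_eq_add_neg]
  exact v.map_lt_add (val_pow_pos hq hz) (by rwa [v.map_neg])

theorem val_pow_sub_self_neg (hq : 1 < q) {z : L} (hz : v z < 0) : v (z ^ q - z) < 0 := by
  obtain ⟨m, hm⟩ := v.exists_coe_eq (z := z) (by rintro rfl; simp at hz)
  have hm0 : m < 0 := by rw [hm] at hz; exact_mod_cast hz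
  have hlt : (q : ℤ) * m < m := by
    have : (1 : ℤ) < q := by exact_mod_cast hq
    nlinarith
  have h1 : v (z ^ q) < v z := by
    rw [pow_eq_coe v hm, hm]
    exact_mod_cast hlt
  rw [map_sub_eq_of_lt_left v h1]
  exact h1.trans hz

/-- `z ↦ z ^ q - z` reduces correctly modulo the maximal ideal. -/
theorem val_pow_sub_self_sub_pos (hq : 0 < q) (hsub : ∀ z w : L, (z - w) ^ q = z ^ q - w ^ q)
    {z : L} {a : K} (hz : 0 < v (z - algebraMap K L a)) :
    0 < v ((z ^ q - z) - algebraMap K L (a ^ q - a)) := by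
  have h := val_pow_sub_self_pos hq hz
  rw [hsub] at h
  rw [_root_.map_sub (algebraMap K L), _root_.map_pow]
  convert h using 2
  ring

/-- The affine centre of a place lies on the curve. -/
theorem center_mul_eq_one (hv : v.TrivialOn K) (hq : 0 < q)
    (hsub : ∀ z w : L, (z - w) ^ q = z ^ q - w ^ q) (hxy : (x ^ q - x) * (y ^ q - y) = 1) {a b : K}
    (ha : 0 < v (x - algebraMap K L a)) (hb : 0 < v (y - algebraMap K L b)) :
    (a ^ q - a) * (b ^ q - b) = 1 := by
  have h1 := val_pow_sub_self_sub_pos hq hsub ha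
  have h2 := val_pow_sub_self_sub_pos hq hsub hb
  set α := a ^ q - a
  set β := b ^ q - b
  set A := (x ^ q - x) - algebraMap K L α with hA
  set B := (y ^ q - y) - algebraMap K L β with hB
  -- The sum is `(α + A)(β + B) - αβ`, that is, the curve equation minus its reduction.
  have h3 : 0 < v (A * B + (algebraMap K L β * A + algebraMap K L α * B)) := by
    refine v.map_lt_add ?_ (v.map_lt_add ?_ ?_)
    · rw [v.map_mul]
      exact add_pos_of_pos_of_nonneg h1 h2.le
    · rw [v.map_mul, add_comm]
      exact add_pos_of_pos_of_nonneg h1 (hv.nonneg _)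
    · rw [v.map_mul, add_comm]
      exact add_pos_of_pos_of_nonneg h2 (hv.nonneg _)
  have h4 : A * B + (algebraMap K L β * A + algebraMap K L α * B)
      = 1 - algebraMap K L (α * β) := by
    rw [hA, hB, _root_.map_mul]
    linear_combination hxy
  rw [h4] at h3
  refine (hv.eq_of_sub_pos (z := 1) h3 (b := 1) ?_)
  simp

/-- A pole of `x` is a pole of `x^q - x`, hence a zero of `y^q - y`. So `y` has no pole, and its
residue `b` satisfies `b^q = b`. -/
theorem exists_root_of_val_neg [IsAlgClosed K] (hv : v.TrivialOn K) (hsurj : Function.Surjective v)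
    (hq : 1 < q) (hsub : ∀ z w : L, (z - w) ^ q = z ^ q - w ^ q)
    (hxy : (x ^ q - x) * (y ^ q - y) = 1) (htop : IntermediateField.adjoin K {x, y} = ⊤)
    (hx : v x < 0) : ∃ b : K, b ^ q - b = 0 ∧ 0 < v (y - algebraMap K L b) := by
  have h1 := val_pow_sub_self_neg hq hx
  have h2 : 0 < v (y ^ q - y) := by
    have h := congrArg v hxy
    rw [v.map_mul, v.map_one] at h
    by_contra! h3
    have := add_neg_of_neg_of_nonpos h1 h3
    rw [h] at this
    exact lt_irrefl _ this
  have h3 : 0 ≤ v y := by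
    by_contra! h3
    exact lt_asymm h2 (val_pow_sub_self_neg hq h3)
  have : Algebra.IsAlgebraic (IntermediateField.adjoin K {y}) L :=
    isAlgebraic hq (by rwa [mul_comm]) (adjoin_swap htop)
  obtain ⟨b, hb⟩ := hv.exists_sub_pos hsurj h3
  refine ⟨b, ?_, hb⟩
  exact hv.eq_of_sub_pos (val_pow_sub_self_sub_pos (by omega) hsub hb) (by simpa using h2)

theorem exists_center [IsAlgClosed K] (hv : v.TrivialOn K) (hsurj : Function.Surjective v)
    (hq : 1 < q) (hxy : (x ^ q - x) * (y ^ q - y) = 1)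
    (htop : IntermediateField.adjoin K {x, y} = ⊤) (hx : 0 ≤ v x) (hy : 0 ≤ v y) :
    ∃ a b : K, 0 < v (x - algebraMap K L a) ∧ 0 < v (y - algebraMap K L b) := by
  have : Algebra.IsAlgebraic (IntermediateField.adjoin K {y}) L :=
    isAlgebraic hq (by rwa [mul_comm]) (adjoin_swap htop)
  have : Algebra.IsAlgebraic (IntermediateField.adjoin K {x}) L := isAlgebraic hq hxy htop
  obtain ⟨a, ha⟩ := hv.exists_sub_pos hsurj hx
  obtain ⟨b, hb⟩ := hv.exists_sub_pos hsurj hy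
  exact ⟨a, b, ha, hb⟩

/-- At infinity the coordinates are `u = 1/x` and `s = y - b`. As `b^q = b`, the curve becomes `(s^q
- s)(1 - u^(q-1)) = u^q`, which is smooth at the origin; dividing both sides into factors `s` and
`u` gives the `w` and `w'` used here. -/
theorem eq_of_val_neg (hv : v.TrivialOn K) (hv' : v'.TrivialOn K)
    (hsurj : Function.Surjective v) (hsurj' : Function.Surjective v')
    (hq : 1 < q) (hsub : ∀ z w : L, (z - w) ^ q = z ^ q - w ^ q)
    (hxy : (x ^ q - x) * (y ^ q - y) = 1) (htop : IntermediateField.adjoin K {x, y} = ⊤)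
    (hx : v x < 0) (hx' : v' x < 0) {b : K} (hb0 : b ^ q - b = 0)
    (hb : 0 < v (y - algebraMap K L b)) (hb' : 0 < v' (y - algebraMap K L b)) : v = v' := by
  have hinv : ∀ w : AddValuation L (WithTop ℤ), w x < 0 → 0 < w x⁻¹ := by
    intro w hw
    obtain ⟨m, hm⟩ := w.exists_coe_eq (z := x) (by rintro rfl; simp at hw)
    rw [inv_eq_coe w hm]
    rw [hm] at hw
    have : m < 0 := by exact_mod_cast hw
    have : 0 < -m := by omega
    exact_mod_cast this
  have hx0 : x ≠ 0 := by
    rintro rfl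
    simp at hx
  have hu := hinv v hx
  have hu' := hinv v' hx'
  have hu_mem : x⁻¹ ∈ Algebra.adjoin K {x⁻¹, y - algebraMap K L b} :=
    Algebra.subset_adjoin (by simp)
  have hs_mem : y - algebraMap K L b ∈ Algebra.adjoin K {x⁻¹, y - algebraMap K L b} :=
    Algebra.subset_adjoin (by simp)
  refine hv.eq_of_pos (w := (1 - (y - algebraMap K L b) ^ (q - 1)) * (1 - x⁻¹ ^ (q - 1)))
    (w' := - x⁻¹ ^ (q - 1)) (adjoin_inv_sub htop b) hv' hsurj hsurj' hu hb hu' hb'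
    (mul_mem (sub_mem (one_mem _) (pow_mem hs_mem _)) (sub_mem (one_mem _) (pow_mem hu_mem _)))
    (neg_mem (pow_mem hu_mem _)) ?_ ?_ ?_
  · have h1 : (y - algebraMap K L b) * (1 - (y - algebraMap K L b) ^ (q - 1)) = -(y ^ q - y) := by
      rw [mul_sub, mul_pow_sub_one (by omega), hsub, ← _root_.map_pow, sub_eq_zero.1 hb0]
      ring
    have h2 : 1 - x⁻¹ ^ (q - 1) = x⁻¹ ^ q * (x ^ q - x) := by
      rw [mul_sub, ← mul_pow, inv_mul_cancel₀ hx0, one_pow]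
      obtain ⟨m, rfl⟩ : ∃ m, q = m + 1 := ⟨q - 1, by omega⟩
      rw [pow_succ, mul_assoc, inv_mul_cancel₀ hx0]
      simp
    rw [← mul_assoc, h1, h2, mul_neg, mul_pow_sub_one (by omega)]
    linear_combination (-x⁻¹ ^ q) * hxy
  · rw [v.map_mul, val_one_sub_pow hq hb, val_one_sub_pow hq hu, add_zero]
  · rw [v'.map_mul, val_one_sub_pow hq hb', val_one_sub_pow hq hu', add_zero]

section Affine

variable {a b : K}

/-- Smoothness at an affine point. Subtracting `αβ = 1` from the translated equation leaves `α(s^q -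
s) = -(t^q - t)(β + s^q - s)`. The factor multiplying `s` is a unit because `α ≠ 0`. -/
theorem local_equation (hq : 1 < q) (hsub : ∀ z w : L, (z - w) ^ q = z ^ q - w ^ q)
    (hxy : (x ^ q - x) * (y ^ q - y) = 1) (hab : (a ^ q - a) * (b ^ q - b) = 1) :
    (y - algebraMap K L b) *
        (- algebraMap K L (a ^ q - a) * (1 - (y - algebraMap K L b) ^ (q - 1))) =
      (x - algebraMap K L a) * ((1 - (x - algebraMap K L a) ^ (q - 1)) *
        (algebraMap K L (b ^ q - b) + (y - algebraMap K L b) ^ q - (y - algebraMap K L b))) := by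
  have h1 : (y - algebraMap K L b) * (1 - (y - algebraMap K L b) ^ (q - 1))
      = (y - algebraMap K L b) - (y - algebraMap K L b) ^ q := by
    rw [mul_sub, mul_pow_sub_one (by omega), mul_one]
  have h2 : (x - algebraMap K L a) * (1 - (x - algebraMap K L a) ^ (q - 1))
      = (x - algebraMap K L a) - (x - algebraMap K L a) ^ q := by
    rw [mul_sub, mul_pow_sub_one (by omega), mul_one]
  have h3 := congrArg (algebraMap K L) hab
  rw [mul_left_comm, h1, ← mul_assoc, h2, hsub, hsub]
  simp only [_root_.map_sub, _root_.map_pow, _root_.map_mul, _root_.map_one] at h3 ⊢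
  linear_combination hxy - h3

theorem eq_of_center_eq (hv : v.TrivialOn K) (hv' : v'.TrivialOn K)
    (hsurj : Function.Surjective v) (hsurj' : Function.Surjective v')
    (hq : 1 < q) (hsub : ∀ z w : L, (z - w) ^ q = z ^ q - w ^ q)
    (hxy : (x ^ q - x) * (y ^ q - y) = 1) (htop : IntermediateField.adjoin K {x, y} = ⊤)
    (ha : 0 < v (x - algebraMap K L a)) (ha' : 0 < v' (x - algebraMap K L a))
    (hb : 0 < v (y - algebraMap K L b)) (hb' : 0 < v' (y - algebraMap K L b)) : v = v' := by
  have hab := center_mul_eq_one hv (by omega) hsub hxy ha hb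
  have hs_mem : y - algebraMap K L b ∈
      Algebra.adjoin K {x - algebraMap K L a, y - algebraMap K L b} :=
    Algebra.subset_adjoin (by simp)
  have ht_mem : x - algebraMap K L a ∈
      Algebra.adjoin K {x - algebraMap K L a, y - algebraMap K L b} :=
    Algebra.subset_adjoin (by simp)
  refine hv.eq_of_pos (adjoin_sub_sub htop a b) hv' hsurj hsurj' ha hb ha' hb' ?_ ?_
    (local_equation hq hsub hxy hab) ?_ ?_
  · exact mul_mem (neg_mem (Subalgebra.algebraMap_mem _ _))
      (sub_mem (one_mem _) (pow_mem hs_mem _))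
  · exact mul_mem (sub_mem (one_mem _) (pow_mem ht_mem _))
      (sub_mem (add_mem (Subalgebra.algebraMap_mem _ _) (pow_mem hs_mem _)) hs_mem)
  · rw [v.map_mul, v.map_neg, hv _ (left_ne_zero_of_mul_eq_one hab), val_one_sub_pow hq hb,
      add_zero]
  · rw [v'.map_mul, v'.map_neg, hv' _ (left_ne_zero_of_mul_eq_one hab), val_one_sub_pow hq hb',
      add_zero]

theorem val_sub_eq_one (hv : v.TrivialOn K) (hsurj : Function.Surjective v)
    (hq : 1 < q) (hsub : ∀ z w : L, (z - w) ^ q = z ^ q - w ^ q)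
    (hxy : (x ^ q - x) * (y ^ q - y) = 1) (htop : IntermediateField.adjoin K {x, y} = ⊤)
    (ha : 0 < v (x - algebraMap K L a)) (hb : 0 < v (y - algebraMap K L b)) :
    v (x - algebraMap K L a) = 1 := by
  have hab := center_mul_eq_one hv (by omega) hsub hxy ha hb
  have hs_mem : y - algebraMap K L b ∈
      Algebra.adjoin K {x - algebraMap K L a, y - algebraMap K L b} :=
    Algebra.subset_adjoin (by simp)
  have ht_mem : x - algebraMap K L a ∈
      Algebra.adjoin K {x - algebraMap K L a, y - algebraMap K L b} :=
    Algebra.subset_adjoin (by simp)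
  refine hv.val_eq_one (adjoin_sub_sub htop a b) hsurj ha hb ?_ ?_
    (local_equation hq hsub hxy hab) ?_
  · exact mul_mem (neg_mem (Subalgebra.algebraMap_mem _ _))
      (sub_mem (one_mem _) (pow_mem hs_mem _))
  · exact mul_mem (sub_mem (one_mem _) (pow_mem ht_mem _))
      (sub_mem (add_mem (Subalgebra.algebraMap_mem _ _) (pow_mem hs_mem _)) hs_mem)
  · rw [v.map_mul, v.map_neg, hv _ (left_ne_zero_of_mul_eq_one hab), val_one_sub_pow hq hb,
      add_zero]

end Affine

end Valuation

end ArtinMumford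

/-! ### Orders of the conics at a general affine place. -/

namespace AddValuation

variable {K L : Type*} [Field K] [Field L] [Algebra K L] {v : AddValuation L (WithTop ℤ)}

theorem coe_add_le_mul {z w : L} {m n : ℤ} (hz : (m : WithTop ℤ) ≤ v z)
    (hw : (n : WithTop ℤ) ≤ v w) : ((m + n : ℤ) : WithTop ℤ) ≤ v (z * w) := by
  rw [map_mul, WithTop.coe_add]
  exact add_le_add hz hw

theorem coe_mul_le_pow {z : L} {m : ℤ} (hz : (m : WithTop ℤ) ≤ v z) (n : ℕ) :
    ((n * m : ℤ) : WithTop ℤ) ≤ v (z ^ n) := by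
  induction n with
  | zero => simp
  | succ n ih =>
    rw [pow_succ, show ((n + 1 : ℕ) * m : ℤ) = n * m + m by push_cast; ring]
    exact coe_add_le_mul ih hz

theorem TrivialOn.le_algebraMap_mul (hv : v.TrivialOn K) (c : K) {z : L} {m : WithTop ℤ}
    (hz : m ≤ v z) : m ≤ v (algebraMap K L c * z) := by
  rw [map_mul]
  exact hz.trans (le_add_of_nonneg_left (hv.nonneg c))

theorem TrivialOn.algebraMap_mul_add_eq (hv : v.TrivialOn K) {c : K} (hc : c ≠ 0) {e r : L}
    (h : v e < v r) : v (algebraMap K L c * e + r) = v e := by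
  have : v (algebraMap K L c * e) = v e := by rw [map_mul, hv c hc, zero_add]
  rw [map_add_eq_of_lt_left v (by rwa [this]), this]

/-- The values on a linear combination of functions with increasing values. -/
theorem TrivialOn.eq_of_linear_combination (hv : v.TrivialOn K) {e₀ e₁ e₂ e₃ : L}
    (h₁ : v e₀ < v e₁) (h₂ : v e₁ < v e₂) (h₃ : v e₂ < v e₃)
    (c₀ c₁ c₂ c₃ : K) {z : L} (hz : z = algebraMap K L c₀ * e₀ + (algebraMap K L c₁ * e₁ +
      (algebraMap K L c₂ * e₂ + algebraMap K L c₃ * e₃))) :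
    z = 0 ∨ v z = v e₀ ∨ v z = v e₁ ∨ v z = v e₂ ∨ v z = v e₃ := by
  have l₃ : v e₃ ≤ v (algebraMap K L c₃ * e₃) := hv.le_algebraMap_mul c₃ le_rfl
  have l₂ : v e₂ ≤ v (algebraMap K L c₂ * e₂ + algebraMap K L c₃ * e₃) :=
    v.map_le_add (hv.le_algebraMap_mul c₂ le_rfl) (h₃.le.trans l₃)
  have l₁ : v e₁ ≤ v (algebraMap K L c₁ * e₁ +
      (algebraMap K L c₂ * e₂ + algebraMap K L c₃ * e₃)) :=
    v.map_le_add (hv.le_algebraMap_mul c₁ le_rfl) (h₂.le.trans l₂)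
  subst hz
  by_cases hc₀ : c₀ = 0
  · by_cases hc₁ : c₁ = 0
    · by_cases hc₂ : c₂ = 0
      · by_cases hc₃ : c₃ = 0
        · simp [hc₀, hc₁, hc₂, hc₃]
        · right; right; right; right
          simp [hc₀, hc₁, hc₂, hv c₃ hc₃]
      · right; right; right; left
        simp only [hc₀, hc₁, _root_.map_zero, zero_mul, zero_add]
        exact hv.algebraMap_mul_add_eq hc₂ (h₃.trans_le l₃)
    · right; right; left
      simp only [hc₀, _root_.map_zero, zero_mul, zero_add]
      exact hv.algebraMap_mul_add_eq hc₁ (h₂.trans_le l₂)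
  · right; left
    exact hv.algebraMap_mul_add_eq hc₀ (h₁.trans_le l₁)

end AddValuation

namespace ArtinMumford

open AddValuation

/-- The value of the tangent hyperbola `t s = β t + α s` at a point of the curve. -/
theorem val_hyperbola {L : Type*} [Field L] {v : AddValuation L (WithTop ℤ)} {q : ℕ} (hq : 2 < q)
    (hsub : ∀ z w : L, (z - w) ^ q = z ^ q - w ^ q) {t s α β : L} (hαβ : α * β = 1)
    (hα : v α = 0) (hβ : v β = 0) (hβ' : v (β ^ (2 * q - 2) - 1) = 0)
    (hts : (α + t ^ q - t) * (β + s ^ q - s) = 1) (ht : v t = (1 : ℤ)) (hs : v s = (1 : ℤ)) :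
    v (t * s - (β * t + α * s)) = (q : ℤ) := by
  have hadd : ∀ {z w : L} {m n : ℤ}, v z = m → v w = n → v (z * w) = ((m + n : ℤ) : WithTop ℤ) := by
    intro z w m n hz hw
    rw [v.map_mul, hz, hw]; rfl
  have hα' : v α = (0 : ℤ) := hα
  have hβ₀ : v β = (0 : ℤ) := hβ
  have htq := pow_eq_coe v ht q
  have hsq := pow_eq_coe v hs q
  rw [mul_one] at htq hsq
  set D := t * s - (β * t + α * s) with hD
  -- `E` gathers the terms of order at least `q + 1` in the expanded curve equation.
  set E := t ^ q * s + t * s ^ q - t ^ q * s ^ q with hE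
  have e1 : D = E - (β * t ^ q + α * s ^ q) := by
    rw [hD, hE]
    linear_combination hts - hαβ
  have hq1 : ((q + 1 : ℤ) : WithTop ℤ) ≤ v E := by
    refine v.map_le_sub (v.map_le_add ?_ ?_) ?_
    · rw [hadd htq hs]
    · rw [hadd ht hsq]
      exact_mod_cast (by omega)
    · rw [hadd htq hsq]
      exact_mod_cast (by omega)
  have hDq : ((q : ℤ) : WithTop ℤ) ≤ v D := by
    rw [e1]
    refine v.map_le_sub (le_trans (by exact_mod_cast (by omega)) hq1) (v.map_le_add ?_ ?_)
    · rw [hadd hβ₀ htq, zero_add]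
    · rw [hadd hα' hsq, zero_add]
  have hN : ((2 : ℤ) : WithTop ℤ) ≤ v (t * s - D) := by
    refine v.map_le_sub ?_ (le_trans (by exact_mod_cast (by omega)) hDq)
    rw [hadd ht hs]
    rfl
  have hNq : ((q + 1 : ℤ) : WithTop ℤ) ≤ v ((t * s - D) ^ q) :=
    le_trans (by exact_mod_cast (by omega)) (coe_mul_le_pow hN q)
  -- Tangency raised to the power `q`: `αs + βt = ts - D` has value at least 2, so `(αs)^q` and
  -- `-(βt)^q` agree up to order `2q ≥ q + 1`.
  have e2 : (α * s) ^ q = (t * s - D) ^ q - (β * t) ^ q := by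
    rw [← hsub]
    congr 1
    rw [hD]; ring
  have e3 : β ^ q * (α * s) ^ q = s ^ q := by
    rw [← mul_pow, ← mul_assoc, mul_comm β, hαβ, one_mul]
  have e4 : β ^ (2 * q - 2) * β = α * β ^ q * β ^ q := by
    rw [← pow_succ, mul_assoc, ← pow_add]
    obtain ⟨m, rfl⟩ : ∃ m, q = m + 1 := ⟨q - 1, by omega⟩
    rw [show 2 * (m + 1) - 2 + 1 = 2 * m + 1 by omega, show m + 1 + (m + 1) = 2 * m + 1 + 1 by omega,
      pow_succ β (2 * m + 1), mul_left_comm, hαβ, mul_one]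
  -- Eliminating `s^q` in `e1` isolates the coefficient of `t^q`; `αβ = 1` turns `αβ^(2q)` into
  -- `β^(2q-2)β`.
  have e5 : D = (β ^ (2 * q - 2) - 1) * (β * t ^ q) + (E - α * β ^ q * (t * s - D) ^ q) := by
    rw [mul_pow β t] at e2
    linear_combination e1 + α * e3 - α * β ^ q * e2 - t ^ q * e4
  have hlead : v ((β ^ (2 * q - 2) - 1) * (β * t ^ q)) = (q : ℤ) := by
    rw [v.map_mul, hβ', zero_add, hadd hβ₀ htq, zero_add]
  have hrest : ((q + 1 : ℤ) : WithTop ℤ) ≤ v (E - α * β ^ q * (t * s - D) ^ q) := by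
    refine v.map_le_sub hq1 ?_
    rwa [v.map_mul, v.map_mul, hα, v.map_pow, hβ, smul_zero, add_zero, zero_add]
  rw [e5, map_add_eq_of_lt_left v, hlead]
  rw [hlead]
  exact lt_of_lt_of_le (by exact_mod_cast (by omega)) hrest

variable {K L : Type*} [Field K] [Field L] [Algebra K L] {q : ℕ} {x y : L}
  {v : AddValuation L (WithTop ℤ)} {a b : K}

/-- The orders of the functions `c₀ + c₁ x + c₂ y + c₃ x y` at a general place. -/
theorem setOf_val_eq (hv : v.TrivialOn K) (hsurj : Function.Surjective v)
    (hq : 2 < q) (hsub : ∀ z w : L, (z - w) ^ q = z ^ q - w ^ q)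
    (hxy : (x ^ q - x) * (y ^ q - y) = 1) (htop : IntermediateField.adjoin K {x, y} = ⊤)
    (ha : 0 < v (x - algebraMap K L a)) (hb : 0 < v (y - algebraMap K L b))
    (hβ : (b ^ q - b) ^ (2 * q - 2) ≠ 1) :
    {i : ℤ | ∃ z ∈ Submodule.span K {1, x, y, x * y}, z ≠ 0 ∧ v z = i} = {0, 1, 2, (q : ℤ)} := by
  have hab := center_mul_eq_one hv (by omega) hsub hxy ha hb
  have ht := val_sub_eq_one hv hsurj (by omega) hsub hxy htop ha hb
  have hs := val_sub_eq_one hv hsurj (by omega) hsub (by rwa [mul_comm]) (adjoin_swap htop) hb ha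
  set t := x - algebraMap K L a with ht_def
  set s := y - algebraMap K L b with hs_def
  set α := a ^ q - a with hα
  set β := b ^ q - b with hβ_def
  have hab' : algebraMap K L α * algebraMap K L β = 1 := by
    rw [← _root_.map_mul, hab, _root_.map_one]
  have hD : v (t * s - (algebraMap K L β * t + algebraMap K L α * s)) = (q : ℤ) := by
    refine val_hyperbola hq hsub hab' (hv _ (left_ne_zero_of_mul_eq_one hab))
      (hv _ (right_ne_zero_of_mul_eq_one hab)) ?_ ?_ ht hs
    · have := hv _ (sub_ne_zero.2 hβ)
      rwa [_root_.map_sub (algebraMap K L), _root_.map_pow, _root_.map_one] at this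
    · rw [← hxy, ht_def, hs_def, hsub, hsub, hα, hβ_def, _root_.map_sub (algebraMap K L),
        _root_.map_pow, _root_.map_sub (algebraMap K L), _root_.map_pow]
      ring
  set D := t * s - (algebraMap K L β * t + algebraMap K L α * s) with hD_def
  set N := algebraMap K L β * t + algebraMap K L α * s with hN_def
  have hN : v N = (2 : ℤ) := by
    have h1 : v (t * s) = (2 : ℤ) := by rw [v.map_mul, ht, hs]; rfl
    rw [show N = t * s - D by rw [hD_def]; ring, map_sub_eq_of_lt_left v, h1]
    rw [h1, hD]
    exact_mod_cast hq
  have h1mem : (1 : L) ∈ Submodule.span K {1, x, y, x * y} := Submodule.subset_span (by simp)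
  have hxmem : x ∈ Submodule.span K {1, x, y, x * y} := Submodule.subset_span (by simp)
  have hymem : y ∈ Submodule.span K {1, x, y, x * y} := Submodule.subset_span (by simp)
  have hxymem : x * y ∈ Submodule.span K {1, x, y, x * y} := Submodule.subset_span (by simp)
  have hcmem : ∀ c : K, algebraMap K L c ∈ Submodule.span K {1, x, y, x * y} := fun c => by
    rw [Algebra.algebraMap_eq_smul_one]
    exact Submodule.smul_mem _ _ h1mem
  have hsmem : ∀ (c : K) (z : L), z ∈ Submodule.span K {1, x, y, x * y} →
      algebraMap K L c * z ∈ Submodule.span K {1, x, y, x * y} := fun c z hz => by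
    rw [← Algebra.smul_def]
    exact Submodule.smul_mem _ _ hz
  have htmem : t ∈ Submodule.span K {1, x, y, x * y} := sub_mem hxmem (hcmem a)
  have hNmem : N ∈ Submodule.span K {1, x, y, x * y} :=
    add_mem (hsmem _ _ htmem) (hsmem _ _ (sub_mem hymem (hcmem b)))
  have hDmem : D ∈ Submodule.span K {1, x, y, x * y} := by
    rw [hD_def, ht_def, hs_def, show (x - algebraMap K L a) * (y - algebraMap K L b) =
      x * y - algebraMap K L b * x - algebraMap K L a * y + algebraMap K L (a * b) by
        rw [_root_.map_mul]; ring]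
    exact sub_mem (add_mem (sub_mem (sub_mem hxymem (hsmem _ _ hxmem)) (hsmem _ _ hymem))
      (hcmem _)) hNmem
  ext i
  simp only [Set.mem_ofPred_eq, Set.mem_insert_iff, Set.mem_singleton_iff]
  constructor
  · rintro ⟨z, hz, hz0, hzi⟩
    obtain ⟨c₀, c₁, c₂, c₃, rfl⟩ : ∃ c₀ c₁ c₂ c₃ : K, z = algebraMap K L c₀ +
        algebraMap K L c₁ * x + algebraMap K L c₂ * y + algebraMap K L c₃ * (x * y) := by
      simp only [Submodule.mem_span_insert, Submodule.mem_span_singleton] at hz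
      obtain ⟨c₀, _, ⟨c₁, _, ⟨c₂, _, ⟨c₃, rfl⟩, rfl⟩, rfl⟩, rfl⟩ := hz
      exact ⟨c₀, c₁, c₂, c₃, by simp only [Algebra.smul_def]; ring⟩
    -- The coefficients come from expanding in `t` and `s`, then substituting `ts = N + D` and `s =
    -- βN - β²t`.
    have key := hv.eq_of_linear_combination (e₀ := 1) (e₁ := t) (e₂ := N) (e₃ := D)
      (by rw [v.map_one, ht]; exact_mod_cast one_pos)
      (by rw [ht, hN]; exact_mod_cast one_lt_two) (by rw [hN, hD]; exact_mod_cast hq)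
      (c₀ + c₁ * a + c₂ * b + c₃ * (a * b))
      (c₁ + c₃ * b - β ^ 2 * (c₂ + c₃ * a))
      (c₃ + β * (c₂ + c₃ * a)) c₃ (z := algebraMap K L c₀ +
        algebraMap K L c₁ * x + algebraMap K L c₂ * y + algebraMap K L c₃ * (x * y)) (by
        simp only [_root_.map_add (algebraMap K L), _root_.map_sub (algebraMap K L),
          _root_.map_mul, _root_.map_pow]
        rw [hD_def, hN_def, ht_def, hs_def]
        linear_combination -(algebraMap K L c₂ + algebraMap K L c₃ * algebraMap K L a) *
          (y - algebraMap K L b) * hab')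
    rw [hzi, v.map_one, ht, hN, hD] at key
    rcases key with h | h | h | h | h
    · exact absurd h hz0
    · left; exact_mod_cast h
    · right; left; exact_mod_cast h
    · right; right; left; exact_mod_cast h
    · right; right; right; exact_mod_cast h
  · have hne : ∀ {z : L} {m : ℤ}, v z = m → z ≠ 0 := by
      rintro z m h rfl
      rw [v.map_zero] at h
      exact WithTop.coe_ne_top h.symm
    rintro (rfl | rfl | rfl | rfl)
    · exact ⟨1, h1mem, one_ne_zero, v.map_one⟩
    · exact ⟨t, htmem, hne ht, ht⟩
    · exact ⟨N, hNmem, hne hN, hN⟩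
    · exact ⟨D, hDmem, hne hD, hD⟩

end ArtinMumford

/-! ### Existence of places from power series parametrizations. -/

/-- An Artin-Schreier equation `y ^ q - y = c` solvable for the constant coefficient of `c` is
solvable in power series. -/
theorem PowerSeries.exists_pow_sub_self_eq {K : Type*} [Field K] {q : ℕ} (hq : 1 < q)
    (hqK : (q : K) = 0) {b : K} {c : PowerSeries K} (hc : constantCoeff c = b ^ q - b) :
    ∃ y : PowerSeries K, y ^ q - y = c := by
  set g : (PowerSeries K)[X] := Polynomial.X ^ q + (-Polynomial.X - Polynomial.C c) with hg
  have hmonic : g.Monic := by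
    refine monic_X_pow_add (lt_of_le_of_lt (b := (1 : WithBot ℕ)) ?_ (by exact_mod_cast hq))
    exact (degree_sub_le _ _).trans (max_le (by simp) (degree_C_le.trans (by simp)))
  have hq0 : (q : PowerSeries K) = 0 := by
    rw [← map_natCast (PowerSeries.C (R := K)), hqK, map_zero]
  -- Hensel lifting from the approximate root `b`: the derivative is `qY^(q-1) - 1 = -1`, a unit.
  obtain ⟨y, hy, -⟩ := HenselianRing.is_henselian (I := Ideal.span {(PowerSeries.X : PowerSeries K)})
    g hmonic (PowerSeries.C b) (by
      rw [Ideal.mem_span_singleton, PowerSeries.X_dvd_iff]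
      simp [hg, hc]
      ring) (by
      simp [hg, Polynomial.derivative_X_pow, hq0])
  refine ⟨y, ?_⟩
  simp only [IsRoot, hg, eval_add, eval_pow, eval_X, eval_sub, eval_neg, eval_C] at hy
  linear_combination hy

namespace PlaneCurve

variable {K : Type*} [Field K] (f : K[X][X])

theorem adjoin_xFun_yFun [Fact (Irreducible f)] :
    IntermediateField.adjoin K {xFun f, yFun f} = ⊤ := by
  rw [eq_top_iff]
  rintro z -
  have hmem : ∀ r : CoordinateRing f, algebraMap (CoordinateRing f) (FunctionField f) r ∈
      IntermediateField.adjoin K {xFun f, yFun f} := by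
    have hx : ∀ g : K[X], algebraMap (CoordinateRing f) (FunctionField f) (AdjoinRoot.of f g) ∈
        IntermediateField.adjoin K {xFun f, yFun f} := by
      intro g
      induction g using Polynomial.induction_on' with
      | add g h hg hh =>
        rw [map_add, map_add]
        exact add_mem hg hh
      | monomial n c =>
        rw [← C_mul_X_pow_eq_monomial, map_mul, map_mul, map_pow, map_pow]
        refine mul_mem ?_ (pow_mem (IntermediateField.mem_adjoin_pair_left K _ _) n)
        exact IntermediateField.algebraMap_mem _ c
    intro r
    induction r using AdjoinRoot.induction_on with
    | ih g =>
    induction g using Polynomial.induction_on' with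
    | add g h hg hh =>
      rw [map_add, map_add]
      exact add_mem hg hh
    | monomial n c =>
      rw [← C_mul_X_pow_eq_monomial, map_mul, map_mul, map_pow, map_pow, AdjoinRoot.mk_X,
        AdjoinRoot.mk_C]
      exact mul_mem (hx c) (pow_mem (IntermediateField.mem_adjoin_pair_right K _ _) n)
  obtain ⟨r, s, -, rfl⟩ := IsFractionRing.div_surjective (A := CoordinateRing f) z
  exact div_mem (hmem r) (hmem s)

theorem algebraMap_eq (c : K) : algebraMap K (FunctionField f) c =
    algebraMap (CoordinateRing f) (FunctionField f) (AdjoinRoot.of f (C c)) := by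
  rfl

variable {f}

theorem isAlgebraic_coordinateRing [Fact (Irreducible f)] :
    Algebra.IsAlgebraic K[X] (CoordinateRing f) := by
  have hf : f ≠ 0 := (Fact.out : Irreducible f).ne_zero
  have hroot : IsAlgebraic K[X] (AdjoinRoot.root f) := ⟨f, hf, by simp [AdjoinRoot.aeval_eq]⟩
  refine ⟨fun r => ?_⟩
  induction r using AdjoinRoot.induction_on with
  | ih g =>
  induction g using Polynomial.induction_on' with
  | add g h hg hh =>
    rw [map_add]
    exact hg.add hh
  | monomial n c =>
    rw [← C_mul_X_pow_eq_monomial, map_mul, map_pow, AdjoinRoot.mk_X, AdjoinRoot.mk_C]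
    exact (isAlgebraic_algebraMap c).mul (hroot.pow n)

/-- A parametrization of the curve whose abscissa is transcendental is injective on the
coordinate ring. -/
theorem injective_of_injective_comp_of [Fact (Irreducible f)] {S : Type*} [CommRing S]
    (φ : CoordinateRing f →+* S) (h : Function.Injective (φ.comp (AdjoinRoot.of f))) :
    Function.Injective φ := by
  rw [RingHom.injective_iff_ker_eq_bot]
  by_contra hne
  obtain ⟨r, hr, hr0⟩ := Submodule.exists_mem_ne_zero_of_ne_bot hne
  -- The coordinate ring is algebraic over `K[X]`, so a nonzero kernel would meet `K[X]`
  -- nontrivially.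
  refine Ideal.comap_ne_bot_of_algebraic_mem (R := K[X]) hr0 hr
    (isAlgebraic_coordinateRing.isAlgebraic r) ?_
  rw [AdjoinRoot.algebraMap_eq, RingHom.comap_ker]
  exact (RingHom.injective_iff_ker_eq_bot _).1 h

/-- A point of the curve over `K⟦T⟧` with abscissa `a + T` defines a place with `x - a` as a
uniformizer. -/
theorem exists_place_of_powerSeries [Fact (Irreducible f)] (a : K) (y : PowerSeries K)
    (hy : f.eval₂ ((coeToPowerSeries.ringHom).comp (taylorAlgHom a : K[X] →+* K[X])) y = 0) :
    ∃ P : Place f, P.val (xFun f - algebraMap K (FunctionField f) a) = 1 := by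
  set ψ : K[X] →+* PowerSeries K := (coeToPowerSeries.ringHom).comp (taylorAlgHom a : K[X] →+* K[X])
    with hψ
  have hψinj : Function.Injective ψ := by
    intro g h hgh
    exact taylor_injective a (Polynomial.coe_injective K hgh)
  set φ : CoordinateRing f →+* LaurentSeries K :=
    (HahnSeries.ofPowerSeries ℤ K).comp (AdjoinRoot.lift ψ y hy) with hφ
  have hφof : φ.comp (AdjoinRoot.of f) = (HahnSeries.ofPowerSeries ℤ K).comp ψ := by
    ext <;> simp [hφ]
  have hφinj : Function.Injective φ := by
    refine injective_of_injective_comp_of φ ?_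
    rw [hφof]
    exact HahnSeries.ofPowerSeries_injective.comp hψinj
  have hC : ∀ c : K, ψ (C c) = PowerSeries.C c := fun c => by simp [hψ]
  have hX : ψ X = PowerSeries.X + PowerSeries.C a := by simp [hψ]
  set Φ : FunctionField f →+* LaurentSeries K := IsFractionRing.lift hφinj
  have hΦ : ∀ g : K[X], Φ (algebraMap (CoordinateRing f) (FunctionField f) (AdjoinRoot.of f g)) =
      HahnSeries.ofPowerSeries ℤ K (ψ g) := fun g => by
    rw [IsFractionRing.lift_algebraMap]
    exact RingHom.congr_fun hφof g
  have hval : ∀ z, (HahnSeries.addVal ℤ K).comap Φ z = (Φ z).orderTop := fun z => rfl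
  have ht : (HahnSeries.addVal ℤ K).comap Φ (xFun f - algebraMap K (FunctionField f) a) = 1 := by
    rw [hval, algebraMap_eq, map_sub, xFun, hΦ, hΦ, hX, hC, map_add, add_sub_cancel_right,
      HahnSeries.ofPowerSeries_X, HahnSeries.orderTop_single one_ne_zero]
    rfl
  refine ⟨⟨(HahnSeries.addVal ℤ K).comap Φ, fun c hc => ?_, fun m => ?_⟩, ht⟩
  · rw [hval, algebraMap_eq, hΦ, hC, HahnSeries.ofPowerSeries_C]
    exact HahnSeries.orderTop_single hc
  -- The powers of `x - a` and their inverses realize every integer, so the valuation is normalized.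
  · induction m with
    | top => exact ⟨0, AddValuation.map_zero _⟩
    | coe m =>
      obtain ⟨n, rfl | rfl⟩ := m.eq_nat_or_neg
      · exact ⟨_, (AddValuation.pow_eq_coe _ ht n).trans (by rw [mul_one])⟩
      · exact ⟨_, (AddValuation.inv_eq_coe _ (AddValuation.pow_eq_coe _ ht n)).trans
          (by rw [mul_one])⟩

end PlaneCurve

namespace ArtinMumford

open PlaneCurve

theorem xFun_yFun_equation (F K : Type*) [Field F] [Finite F] [Field K] :
    (xFun (artinMumford F K) ^ Nat.card F - xFun (artinMumford F K)) *
      (yFun (artinMumford F K) ^ Nat.card F - yFun (artinMumford F K)) = 1 := by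
  have h : AdjoinRoot.mk (artinMumford F K)
      (C (X ^ Nat.card F - X) * (X ^ Nat.card F - X) - 1) = 0 := AdjoinRoot.mk_self
  have h' := congrArg (algebraMap (CoordinateRing (artinMumford F K))
    (FunctionField (artinMumford F K))) h
  simp only [map_sub, map_mul, map_pow, map_one, map_zero, AdjoinRoot.mk_X, AdjoinRoot.mk_C] at h'
  exact sub_eq_zero.1 h'

/-- Put `x = a + T`. Then `x^q - x` is a unit of `K⟦T⟧`, and `y` is found by solving `y^q - y = (x^q
- x)⁻¹`, whose constant term `b^q - b` is of the required form. -/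
theorem exists_place {F K : Type*} [Field F] [Finite F] [Field K] (hqK : (Nat.card F : K) = 0)
    {a b : K} (hab : (a ^ Nat.card F - a) * (b ^ Nat.card F - b) = 1) :
    ∃ P : Place (artinMumford F K),
      P.val (xFun (artinMumford F K) - algebraMap K (FunctionField (artinMumford F K)) a) = 1 := by
  set q := Nat.card F
  set A : PowerSeries K := (PowerSeries.X + PowerSeries.C a) ^ q - (PowerSeries.X + PowerSeries.C a)
    with hA
  have hq : 1 < q := Finite.one_lt_card
  have hA0 : PowerSeries.constantCoeff A = a ^ q - a := by simp [hA]
  have hA0' : PowerSeries.constantCoeff A ≠ 0 := by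
    rw [hA0]
    exact left_ne_zero_of_mul_eq_one hab
  obtain ⟨y, hy⟩ := PowerSeries.exists_pow_sub_self_eq hq hqK (b := b) (c := A⁻¹) (by
    rw [PowerSeries.constantCoeff_inv, hA0]
    exact inv_eq_of_mul_eq_one_right hab)
  refine exists_place_of_powerSeries a y ?_
  have h := PowerSeries.mul_inv_cancel A hA0'
  rw [← hy, hA] at h
  simp [artinMumford, eval₂_mul, eval₂_sub, eval₂_pow, eval₂_C, eval₂_X, q, h]

end ArtinMumford

/-! ### The conics as functions on the curve, and their order sets. -/

namespace PlaneCurve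

variable {K : Type*} [Field K]

/-- A conic through the coordinate point `e_j` has no `X_j ^ 2` term. -/
theorem le_one_of_mem_support {H : MvPolynomial (Fin 3) K} (hH : H.IsHomogeneous 2) (j : Fin 3)
    (h0 : MvPolynomial.eval (Pi.single j 1) H = 0) {d : Fin 3 →₀ ℕ} (hd : d ∈ H.support) :
    d j ≤ 1 := by
  by_contra! hlt
  have hdeg : ∀ e ∈ H.support, ∑ i, e i = 2 := fun e he => by
    rw [← Finsupp.degree_eq_sum, Finsupp.degree_eq_weight_one]
    exact hH (MvPolynomial.mem_support_iff.1 he)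
  have hle : ∀ e ∈ H.support, 2 ≤ e j → e = Finsupp.single j 2 := by
    intro e he h2
    have h := hdeg e he
    rw [← Finset.add_sum_erase _ _ (Finset.mem_univ j)] at h
    ext i
    by_cases hi : i = j
    · subst hi
      rw [Finsupp.single_eq_same]
      omega
    · rw [Finsupp.single_eq_of_ne hi]
      have := Finset.single_le_sum (f := fun i => e i) (fun _ _ => Nat.zero_le _)
        (Finset.mem_erase.2 ⟨hi, Finset.mem_univ i⟩)
      omega
  -- Evaluation at `e_j` kills every monomial except `X_j ^ 2`, so it returns the coefficient at
  -- `d`.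
  refine MvPolynomial.mem_support_iff.1 hd ?_
  rw [MvPolynomial.eval_eq', Finset.sum_eq_single d] at h0
  · rw [hle d hd hlt] at h0 ⊢
    rw [Finset.prod_eq_one, mul_one] at h0
    · exact h0
    · intro i _
      by_cases hi : i = j
      · subst hi; simp
      · simp [Finsupp.single_eq_of_ne hi]
  · intro e he hne
    obtain ⟨i, hij, hi⟩ : ∃ i, i ≠ j ∧ e i ≠ 0 := by
      by_contra! hall
      refine hne ((hle e he ?_).trans (hle d hd hlt).symm)
      have h := hdeg e he
      rw [Finset.sum_eq_single j (fun i _ hi => hall i hi) (by simp)] at h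
      exact h.ge
    rw [Finset.prod_eq_zero (Finset.mem_univ i), mul_zero]
    rw [Pi.single_eq_of_ne hij, zero_pow hi]
  · exact fun h => absurd hd h

/-- The functions cut out on a curve by the conics through `O₁` and `O₂`. -/
theorem restrict_image_conicsThroughO₁O₂ (f : K[X][X]) :
    restrict f '' (conicsThroughO₁O₂ K : Set (MvPolynomial (Fin 3) K)) =
      Submodule.span K {1, xFun f, yFun f, xFun f * yFun f} := by
  have e0 : (![1, 0, 0] : Fin 3 → K) = Pi.single 0 1 := by
    ext i; fin_cases i <;> rfl
  have e1 : (![0, 1, 0] : Fin 3 → K) = Pi.single 1 1 := by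
    ext i; fin_cases i <;> rfl
  ext z
  constructor
  · rintro ⟨H, ⟨hH, hQ⟩, rfl⟩
    have h0 := hQ ![1, 0, 0] (by simp)
    have h1 := hQ ![0, 1, 0] (by simp)
    rw [e0] at h0
    rw [e1] at h1
    rw [restrict, MvPolynomial.aeval_def, MvPolynomial.eval₂_eq']
    refine Submodule.sum_mem _ fun d hd => ?_
    rw [← Algebra.smul_def]
    refine Submodule.smul_mem _ _ ?_
    have hd0 := le_one_of_mem_support hH 0 h0 hd
    have hd1 := le_one_of_mem_support hH 1 h1 hd
    simp only [Fin.prod_univ_three, Matrix.cons_val_zero, Matrix.cons_val_one, Matrix.cons_val,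
      one_pow, mul_one]
    refine Submodule.subset_span ?_
    -- Only the exponents of `X` and `Y` matter, as the third coordinate is 1; the four cases are
    -- `1, y, x, xy`.
    interval_cases d 0 <;> interval_cases d 1 <;> simp
  · intro hz
    simp only [SetLike.mem_coe, Submodule.mem_span_insert, Submodule.mem_span_singleton] at hz
    obtain ⟨c₀, _, ⟨c₁, _, ⟨c₂, _, ⟨c₃, rfl⟩, rfl⟩, rfl⟩, rfl⟩ := hz
    refine ⟨MvPolynomial.C c₀ * (MvPolynomial.X 2 * MvPolynomial.X 2) +
      (MvPolynomial.C c₁ * (MvPolynomial.X 0 * MvPolynomial.X 2) +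
      (MvPolynomial.C c₂ * (MvPolynomial.X 1 * MvPolynomial.X 2) +
      MvPolynomial.C c₃ * (MvPolynomial.X 0 * MvPolynomial.X 1))), ⟨?_, ?_⟩, ?_⟩
    · have key : ∀ (c : K) (i j : Fin 3),
          (MvPolynomial.C c * (MvPolynomial.X i * MvPolynomial.X j)).IsHomogeneous 2 :=
        fun c i j => (MvPolynomial.isHomogeneous_C (Fin 3) c).mul
          ((MvPolynomial.isHomogeneous_X K i).mul (MvPolynomial.isHomogeneous_X K j))
      exact (key _ _ _).add ((key _ _ _).add ((key _ _ _).add (key _ _ _)))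
    · rintro Q (rfl | rfl) <;> simp
    · simp [restrict, Algebra.smul_def]

variable {f : K[X][X]} [Fact (Irreducible f)]

theorem Place.multSet_conicsThroughO₁O₂ (P : Place f) (hx : 0 ≤ P.val (xFun f))
    (hy : 0 ≤ P.val (yFun f)) :
    P.multSet 2 (conicsThroughO₁O₂ K) =
      {i : ℤ | ∃ z ∈ Submodule.span K {1, xFun f, yFun f, xFun f * yFun f}, z ≠ 0 ∧ P.val z = i} := by
  -- Without poles the coordinates `(x : y : 1)` are already normalized, so intersection
  -- multiplicities are plain values.
  have hmin : P.coordMin = 0 := by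
    rw [Place.coordMin, P.val.map_one, min_eq_right (le_min hx hy)]
    rfl
  have hord : ∀ z : FunctionField f, z ≠ 0 → ∀ i : ℤ, P.ord z = i ↔ P.val z = i := by
    intro z hz i
    obtain ⟨m, hm⟩ := P.val.exists_coe_eq hz
    rw [Place.ord, hm, WithTop.untopD_coe, WithTop.coe_inj]
  ext i
  simp only [Place.multSet, Place.intersectionMult, hmin, mul_zero, sub_zero, Set.mem_ofPred_eq]
  constructor
  · rintro ⟨H, hH, hne, h⟩
    refine ⟨restrict f H, ?_, hne, (hord _ hne i).1 h⟩
    rw [← SetLike.mem_coe, ← restrict_image_conicsThroughO₁O₂]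
    exact ⟨H, hH, rfl⟩
  · rintro ⟨z, hz, hne, h⟩
    rw [← SetLike.mem_coe, ← restrict_image_conicsThroughO₁O₂] at hz
    obtain ⟨H, hH, rfl⟩ := hz
    exact ⟨H, hH, hne, (hord _ hne i).2 h⟩

theorem Place.orderSet_eq_of_multSet_eq (P : Place f) {t : ℕ}
    {Λ : Submodule K (MvPolynomial (Fin 3) K)} {S : Set ℕ} (h0 : 0 ∈ S)
    (h : P.multSet t Λ = ((↑) : ℕ → ℤ) '' S) : P.orderSet t Λ = S := by
  have hleast : IsLeast (P.multSet t Λ) 0 := by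
    rw [h]
    refine ⟨⟨0, h0, rfl⟩, ?_⟩
    rintro _ ⟨n, -, rfl⟩
    exact Int.natCast_nonneg n
  ext j
  constructor
  · rintro ⟨b, hb, hj⟩
    rw [hb.unique hleast, zero_add, h] at hj
    obtain ⟨n, hn, hnj⟩ := hj
    rwa [← Int.natCast_inj.1 hnj]
  · intro hj
    refine ⟨0, hleast, ?_⟩
    rw [zero_add, h]
    exact ⟨j, hj, rfl⟩

end PlaneCurve

theorem PlaneCurve.Place.val_injective {K : Type*} [Field K] {f : K[X][X]} [Fact (Irreducible f)] :
    Function.Injective (Place.val : Place f → _) := by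
  rintro ⟨⟩ ⟨⟩ h
  cases h
  rfl

/-! ### Finitely many exceptional places among infinitely many. -/

namespace ArtinMumford

open PlaneCurve

theorem finite_pow_sub_self_eq_zero {K : Type*} [Field K] {q : ℕ} (hq : 1 < q) :
    {b : K | b ^ q - b = 0}.Finite := by
  have h := Polynomial.finite_setOfPred_isRoot (FiniteField.X_pow_card_sub_X_ne_zero K hq)
  simpa [IsRoot] using h

theorem finite_pow_sub_self_pow_eq_one {K : Type*} [Field K] {q : ℕ} (hq : 1 < q) :
    {b : K | (b ^ q - b) ^ (2 * q - 2) = 1}.Finite := by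
  have hne : ((X ^ q - X) ^ (2 * q - 2) - 1 : K[X]) ≠ 0 := by
    intro h
    have := congrArg (eval 0) h
    simp [show q ≠ 0 by omega, show 2 * q - 2 ≠ 0 by omega] at this
  have h := Polynomial.finite_setOfPred_isRoot hne
  simpa [IsRoot, sub_eq_zero] using h

section

variable {F K : Type*} [Field F] [Finite F] [Field K]

/-- Every `a` with `a^q ≠ a` is the abscissa of a point of the curve, hence of a place, and the
place determines `a`. -/
theorem infinite_place [IsAlgClosed K] (hqK : (Nat.card F : K) = 0) :
    Infinite (Place (artinMumford F K)) := by
  have hq : 1 < Nat.card F := Finite.one_lt_card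
  have hinf : Infinite K := IsAlgClosed.instInfinite
  have hne : ({a : K | a ^ Nat.card F - a = 0}ᶜ).Infinite :=
    (finite_pow_sub_self_eq_zero hq).infinite_compl
  have : Infinite ↥({a : K | a ^ Nat.card F - a = 0}ᶜ) := hne.to_subtype
  have hex : ∀ a : ↥({a : K | a ^ Nat.card F - a = 0}ᶜ), ∃ P : Place (artinMumford F K),
      P.val (xFun (artinMumford F K) - algebraMap K _ a.1) = 1 := by
    rintro ⟨a, ha⟩
    obtain ⟨b, hb⟩ : ∃ b : K, b ^ Nat.card F - b = (a ^ Nat.card F - a)⁻¹ := by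
      obtain ⟨b, hb⟩ := IsAlgClosed.exists_root (X ^ Nat.card F + (- X -
        C (a ^ Nat.card F - a)⁻¹) : K[X]) (by
          rw [degree_add_eq_left_of_degree_lt]
          · simp only [degree_X_pow]
            exact_mod_cast (by omega : Nat.card F ≠ 0)
          · rw [degree_X_pow]
            refine lt_of_le_of_lt (b := (1 : WithBot ℕ)) ?_ (by exact_mod_cast hq)
            exact (degree_sub_le _ _).trans (max_le (by simp) (degree_C_le.trans (by simp))))
      refine ⟨b, ?_⟩
      simp only [IsRoot, eval_add, eval_pow, eval_X, eval_sub, eval_neg, eval_C] at hb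
      linear_combination hb
    exact exists_place hqK (b := b) (by rw [hb]; exact mul_inv_cancel₀ ha)
  choose P hP using hex
  refine Infinite.of_injective P fun a a' h => Subtype.ext ?_
  have h1 := hP a
  have h2 := hP a'
  rw [← h] at h2
  refine AddValuation.TrivialOn.eq_of_sub_pos (P a).val_const (z := xFun (artinMumford F K)) ?_ ?_
  · rw [h1]; exact_mod_cast one_pos
  · rw [h2]; exact_mod_cast one_pos

theorem orderSet_eq (hq : 2 < Nat.card F)
    (hsub : ∀ z w : FunctionField (artinMumford F K),
      (z - w) ^ Nat.card F = z ^ Nat.card F - w ^ Nat.card F)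
    (P : Place (artinMumford F K)) {a b : K}
    (ha : 0 < P.val (xFun (artinMumford F K) - algebraMap K _ a))
    (hb : 0 < P.val (yFun (artinMumford F K) - algebraMap K _ b))
    (hx : 0 ≤ P.val (xFun (artinMumford F K))) (hy : 0 ≤ P.val (yFun (artinMumford F K)))
    (hβ : (b ^ Nat.card F - b) ^ (2 * Nat.card F - 2) ≠ 1) :
    P.orderSet 2 (conicsThroughO₁O₂ K) = {0, 1, 2, Nat.card F} := by
  refine P.orderSet_eq_of_multSet_eq (by simp) ?_
  rw [P.multSet_conicsThroughO₁O₂ hx hy, setOf_val_eq P.val_const P.val_surjective hq hsub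
    (xFun_yFun_equation F K) (adjoin_xFun_yFun _) ha hb hβ]
  simp [Set.image_insert_eq]

theorem finite_orderSet_ne [IsAlgClosed K] (hq : 2 < Nat.card F)
    (hsub : ∀ z w : FunctionField (artinMumford F K),
      (z - w) ^ Nat.card F = z ^ Nat.card F - w ^ Nat.card F) :
    {P : Place (artinMumford F K) |
      P.orderSet 2 (conicsThroughO₁O₂ K) ≠ {0, 1, 2, Nat.card F}}.Finite := by
  set q := Nat.card F
  set x := xFun (artinMumford F K)
  set y := yFun (artinMumford F K)
  have hq1 : 1 < q := by omega
  have hxy : (x ^ q - x) * (y ^ q - y) = 1 := xFun_yFun_equation F K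
  have hyx : (y ^ q - y) * (x ^ q - x) = 1 := by rwa [mul_comm]
  have htop : IntermediateField.adjoin K {x, y} = ⊤ := adjoin_xFun_yFun _
  have hx_inf : (⋃ b ∈ {b : K | b ^ q - b = 0}, {P : Place (artinMumford F K) |
      P.val x < 0 ∧ 0 < P.val (y - algebraMap K _ b)}).Finite := by
    refine (finite_pow_sub_self_eq_zero hq1).biUnion fun b hb => Set.Subsingleton.finite ?_
    rintro P ⟨h1, h2⟩ Q ⟨h1', h2'⟩
    exact Place.val_injective (eq_of_val_neg P.val_const Q.val_const P.val_surjective Q.val_surjective hq1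
      hsub hxy htop h1 h1' hb h2 h2')
  have hy_inf : (⋃ a ∈ {a : K | a ^ q - a = 0}, {P : Place (artinMumford F K) |
      P.val y < 0 ∧ 0 < P.val (x - algebraMap K _ a)}).Finite := by
    refine (finite_pow_sub_self_eq_zero hq1).biUnion fun b hb => Set.Subsingleton.finite ?_
    rintro P ⟨h1, h2⟩ Q ⟨h1', h2'⟩
    exact Place.val_injective (eq_of_val_neg P.val_const Q.val_const P.val_surjective Q.val_surjective hq1
      hsub hyx (adjoin_swap htop) h1 h1' hb h2 h2')
  have haff : (⋃ a ∈ {a : K | (a ^ q - a) ^ (2 * q - 2) = 1},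
      ⋃ b ∈ {b : K | (b ^ q - b) ^ (2 * q - 2) = 1}, {P : Place (artinMumford F K) |
      0 < P.val (x - algebraMap K _ a) ∧ 0 < P.val (y - algebraMap K _ b)}).Finite := by
    refine (finite_pow_sub_self_pow_eq_one hq1).biUnion fun a _ =>
      (finite_pow_sub_self_pow_eq_one hq1).biUnion fun b _ => Set.Subsingleton.finite ?_
    rintro P ⟨h1, h2⟩ Q ⟨h1', h2'⟩
    exact Place.val_injective (eq_of_center_eq P.val_const Q.val_const P.val_surjective Q.val_surjective hq1
      hsub hxy htop h1 h1' h2 h2')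
  refine ((hx_inf.union hy_inf).union haff).subset fun P hP => ?_
  rcases lt_or_ge (P.val x) 0 with hx | hx
  · obtain ⟨b, hb, h⟩ :=
      exists_root_of_val_neg P.val_const P.val_surjective hq1 hsub hxy htop hx
    exact Or.inl (Or.inl (Set.mem_biUnion (Set.mem_ofPred.2 hb) ⟨hx, h⟩))
  rcases lt_or_ge (P.val y) 0 with hy | hy
  · obtain ⟨a, ha, h⟩ :=
      exists_root_of_val_neg P.val_const P.val_surjective hq1 hsub hyx (adjoin_swap htop) hy
    exact Or.inl (Or.inr (Set.mem_biUnion (Set.mem_ofPred.2 ha) ⟨hy, h⟩))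
  obtain ⟨a, b, ha, hb⟩ := exists_center P.val_const P.val_surjective hq1 hxy htop hx hy
  have hβ : (b ^ q - b) ^ (2 * q - 2) = 1 := by
    by_contra hβ
    exact hP (orderSet_eq hq hsub P ha hb hx hy hβ)
  -- `αβ = 1` transfers the condition from `β` to `α`, so both coordinates of the centre range over
  -- finite sets.
  have hα : (a ^ q - a) ^ (2 * q - 2) = 1 := by
    have h := congrArg (· ^ (2 * q - 2))
      (center_mul_eq_one P.val_const (by omega) hsub hxy ha hb)
    simpa only [mul_pow, hβ, mul_one, one_pow] using h
  exact Or.inr (Set.mem_biUnion (Set.mem_ofPred.2 hα)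
    (Set.mem_biUnion (Set.mem_ofPred.2 hβ) ⟨ha, hb⟩))

end

theorem strictMono_orders {q : ℕ} (hq : 2 < q) : StrictMono ![0, 1, 2, q] := by
  intro i j hij
  fin_cases i <;> fin_cases j <;> simp at hij ⊢ <;> omega

theorem range_orders (q : ℕ) : Set.range ![0, 1, 2, q] = {0, 1, 2, q} := by
  ext j
  simp [eq_comm]
  tauto

end ArtinMumford

theorem lemma5p6 {F K : Type*} [Field F] [Finite F] [Field K] [Algebra F K] [IsAlgClosure F K]
    (p : ℕ) [CharP F p] (hp : 3 < p) :
    ¬ PlaneCurve.IsClassical (artinMumford F K) 2 (conicsThroughO₁O₂ K) ∧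
      PlaneCurve.IsOrderSequence (artinMumford F K) 2 (conicsThroughO₁O₂ K)
        ![0, 1, 2, Nat.card F] := by
  have : IsAlgClosed K := IsAlgClosure.isAlgClosed F
  have := Fintype.ofFinite F
  obtain ⟨n, hprime, hcard⟩ := FiniteField.card F p
  rw [← Nat.card_eq_fintype_card] at hcard
  have : Fact p.Prime := ⟨hprime⟩
  have hpq : p ≤ Nat.card F := by
    rw [hcard]
    exact Nat.le_self_pow n.ne_zero p
  have : CharP K p := charP_of_injective_algebraMap (algebraMap F K).injective p
  have : CharP (PlaneCurve.FunctionField (artinMumford F K)) p :=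
    charP_of_injective_algebraMap
      (algebraMap K (PlaneCurve.FunctionField (artinMumford F K))).injective p
  have hqK : (Nat.card F : K) = 0 := by
    rw [hcard, Nat.cast_pow, CharP.cast_eq_zero, zero_pow n.ne_zero]
  have hfin := ArtinMumford.finite_orderSet_ne (F := F) (K := K) (by omega) fun z w => by
    rw [hcard]
    exact sub_pow_expChar_pow z w n (p := p)
  constructor
  · rintro ⟨r, -, hr⟩
    have := ArtinMumford.infinite_place (F := F) hqK
    -- At a place outside both exceptional sets, `{0, …, r} = {0, 1, 2, q}`. Then `q ≤ r` puts 3 in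
    -- the set, although `q ≥ p > 3`.
    obtain ⟨P, hP⟩ := (hr.union hfin).exists_notMem
    simp only [Set.mem_union, Set.mem_ofPred_eq, not_or, not_not] at hP
    have heq := hP.1.symm.trans hP.2
    obtain ⟨i, hi⟩ : Nat.card F ∈ Set.range fun i : Fin (r + 1) => (i : ℕ) := by
      rw [heq]; simp
    have h3 : 3 ∈ Set.range fun i : Fin (r + 1) => (i : ℕ) :=
      ⟨⟨3, by have := i.2; simp only at hi; omega⟩, rfl⟩
    rw [heq] at h3
    simp only [Set.mem_insert_iff, Set.mem_singleton_iff] at h3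
    omega
  · refine ⟨?_, ?_⟩
    · exact ArtinMumford.strictMono_orders (by omega)
    · rw [ArtinMumford.range_orders]
      exact hfin
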